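/- A symmetric configuration $v_k$ is an incidence structure with $v$ points and $v$ lines such that each line contains $k$ points, each point lies on $k$ lines, and two distinct points lie on at most one common line; its incidence matrix $\mathbf M(v,k)$ has rows indexed by lines and columns by points. A $td\times td$ $0,1$-matrix, viewed as a $t\times t$ matrix of $d\times d$ blocks $C_{i,j}$, is block double-circulant (BDC) with weight vector $(w_0,\dots,w_{t-1})$ if every block is circulant and $C_{i,j}$ has $w_{(j-i)\bmod t}$ ones in each row. If points and lines of a structure are indexed by $\mathbb Z_{td}$ so that adding $1$ to all indices preserves incidence (a cyclic numbering), the arranged matrix is the incidence matrix in which row and column positions $ad+b$ ($0\le a<t$, $0\le b<d$) carry the line and the point with index $bt+a$. Procedure E turns a matrix $\mathbf M(v,k)$ into a $(v+1)\times(v+1)$ matrix: choose $k-1$ rows (pairwise disjoint lines) and $k-1$ columns (pairwise non-collinear points) whose common submatrix is a permutation matrix; add a new row and a new column having ones exactly in the chosen columns, in the chosen rows, and in the common corner; and replace the ones of that permutation submatrix by zeros. Say that a BDC matrix $\mathbf A$ with block size $d$ yields $(cd+\theta)_k$ if, by keeping its first $c$ block rows and block columns and dismissing ones, one obtains a BDC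 incidence matrix of a configuration $(cd)_k$ with all weights in $\{0,1\}$, to which $\theta$ successive applications of Procedure E give an incidence matrix of a symmetric configuration $(cd+\theta)_k$. (i) Let $q$ be a prime power. The starred affine plane of order $q$ (the points of $AG(2,q)$ other than the origin and the lines not through the origin) is a configuration $(q^2-1)_q$ and has a cyclic numbering whose arranged matrix with $t=q+1$, $d=q-1$ is BDC with weight vector $(0,1,\dots,1)$. This matrix yields, and hence there exist, symmetric configurations $v_k$ with $$v=c(q-1)+\theta,\quad k=c-1-\delta,\qquad c=2,\dots,q+1,\ \theta=0,1,\dots,c+1,\ 0\le\delta<c-1.$$ (ii) Let $p$ be a prime and $g$ a primitive root modulo $p$. The residues $e_u=pu+(p-1)g^u \bmod (p^2-p)$, $u=1,\dots,p-1$, form a $(p^2-p,p-1)$ modular Golomb ruler (they are $p-1$ distinct residues, and all differences of two different ones are distinct). Consider the configuration $(p^2-p)_{p-1}$ in which point $i$ lies on line $j$ ($i,j\in\mathbb Z_{p^2-p}$) if and only if $i-j$ is one of the $e_u$. Its arranged matrix with $t=p-1$, $d=p$ is BDC with weight vector $(1,\dots,1)$; it yields, and hence there exist, symmetric configurations $v_k$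 with $$v=cp+\theta,\quad k=c-\delta,\qquad c=2,\dots,p-1,\ \theta=0,1,\dots,c+1,\ 0\le\delta<c.$$ Its arranged matrix with $t=p$, $d=p-1$ is BDC with weight vector $(0,1,\dots,1)$; it yields, and hence there exist, symmetric configurations $v_k$ with $$v=c(p-1)+\theta,\quad k=c-1-\delta,\qquad c=2,\dots,p,\ \theta=0,1,\dots,c+1,\ 0\le\delta<c-1.$$ (iii) Let $q$ be a prime power that is a square. The plane $PG(2,q)$ is a configuration $(q^2+q+1)_{q+1}$ and has a cyclic numbering such that, with $t=q-\sqrt q+1$ and $d=q+\sqrt q+1$, each of the $t$ sets of points whose indices are congruent modulo $t$ is a Baer subplane (a subplane of order $\sqrt q$), and the arranged matrix is BDC with weight vector $(\sqrt q+1,1,\dots,1)$. This matrix yields, and hence there exist, symmetric configurations $v_k$ with $$v=c(q+\sqrt q+1)+\theta,\quad k=c-\delta,\qquad c=2,\dots,q-\sqrt q+1,\ \theta=0,1,\dots,c+1,\ 0\le\delta<c.$$ -/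

import Mathlib

open scoped LinearAlgebra.Projectivization

/-- The incidence relation `I` between points `P` and lines `L` is a symmetric configuration `v_k`:
`v` points, `v` lines, `k` points on each line, `k` lines through each point, and at most one line
through two distinct points. -/
structure IsSymmConfig {P L : Type*} [Fintype P] [Fintype L] (I : P → L → Prop) (v k : ℕ) :
    Prop where
  card_points : Fintype.card P = v
  card_lines : Fintype.card L = v
  points_on_line : ∀ l : L, Nat.card {p : P // I p l} = k
  lines_through_point : ∀ p : P, Nat.card {l : L // I p l} = k
  unique_line : ∀ p p' : P, p ≠ p' → ∀ l l' : L, I p l → I p' l → I p l' → I p' l' → l = l'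

/-- There exists a symmetric configuration `v_k`. -/
def ExistsSymmConfig (v k : ℕ) : Prop :=
  ∃ I : Fin v → Fin v → Prop, IsSymmConfig I v k

/-- All entries of the matrix are `0` or `1`. -/
def IsZeroOne {m n : Type*} (M : Matrix m n ℕ) : Prop :=
  ∀ i j, M i j = 0 ∨ M i j = 1

/-- `M` is an incidence matrix `M(v, k)` of a symmetric configuration `v_k`
(rows are lines, columns are points). -/
def IsConfigMatrix {n : Type*} [Fintype n] (M : Matrix n n ℕ) (v k : ℕ) : Prop :=
  IsZeroOne M ∧ IsSymmConfig (fun (p : n) (l : n) => M l p = 1) v k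

/-- The `d × d` block in block position `(i, j)` of a `t × t` block matrix. -/
def block {t d : ℕ} (A : Matrix (Fin t × Fin d) (Fin t × Fin d) ℕ) (i j : Fin t) :
    Matrix (Fin d) (Fin d) ℕ :=
  Matrix.of fun a b => A (i, a) (j, b)

/-- `A` is block double-circulant with weight vector `w`: every block is a circulant `0,1`-matrix,
and every row of the block in block position `(i, j)` contains `w (j - i mod t)` units. -/
def IsBDC {t d : ℕ} (A : Matrix (Fin t × Fin d) (Fin t × Fin d) ℕ) (w : Fin t → ℕ) : Prop :=
  IsZeroOne A ∧ ∀ i j : Fin t,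
    (∃ u : Fin d → ℕ, block A i j = Matrix.circulant u) ∧
    ∀ a : Fin d, ∑ b, block A i j a b = w (j - i)

/-- The matrix obtained from the cyclically indexed incidence relation `J` (first argument a point,
second argument a line, both indexed by integers modulo `t * d`) when rows and columns are
rearranged so that the position `a * d + b`, with `a < t` and `b < d`, receives the index
`b * t + a`. -/
noncomputable def arranged (t d : ℕ) (J : ZMod (t * d) → ZMod (t * d) → Prop) :
    Matrix (Fin t × Fin d) (Fin t × Fin d) ℕ :=
  open Classical in
  Matrix.of fun x y =>
    if J (((y.2 : ℕ) * t + (y.1 : ℕ) : ℕ) : ZMod (t * d))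
        (((x.2 : ℕ) * t + (x.1 : ℕ) : ℕ) : ZMod (t * d)) then 1 else 0

/-- Points and lines are numbered by the integers modulo `v` so that adding `1` to all indices
preserves incidence; that is, `e i ↦ e (i + 1)` is an automorphism which acts regularly on points
and on lines. -/
def IsCyclicNumbering {P L : Type*} (I : P → L → Prop) {v : ℕ} (e : ZMod v ≃ P)
    (f : ZMod v ≃ L) : Prop :=
  ∀ i j, I (e (i + 1)) (f (j + 1)) ↔ I (e i) (f j)

/-- `S` is a `(v, k)` modular Golomb ruler, as a set of residues modulo `v`. -/
def IsModularGolombRuler (v k : ℕ) (S : Finset (ZMod v)) : Prop :=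
  S.card = k ∧ ∀ a ∈ S, ∀ b ∈ S, ∀ a' ∈ S, ∀ b' ∈ S,
    a ≠ b → a' ≠ b' → a - b = a' - b' → a = a' ∧ b = b'

/-- The residues `p * u + (p - 1) * g ^ u` modulo `v`, for `u = 1, …, p - 1`
(to be used with `v = p ^ 2 - p`). -/
def ruzsa (p g v : ℕ) : Finset (ZMod v) :=
  (Finset.Icc 1 (p - 1)).image fun u => ((p * u + (p - 1) * g ^ u : ℕ) : ZMod v)

/-- Points of the starred affine plane over `F`: all points of `AG(2, F)` but the origin. -/
abbrev StarredPoint (F : Type*) [Field F] : Type _ := {x : F × F // x ≠ 0}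

/-- Lines of the starred affine plane over `F`: all lines of `AG(2, F)` not through the origin. -/
abbrev StarredLine (F : Type*) [Field F] : Type _ :=
  {l : AffineSubspace F (F × F) // Module.finrank F l.direction = 1 ∧ (0 : F × F) ∉ l}

/-- Incidence in the starred affine plane. -/
def starredInc (F : Type*) [Field F] (p : StarredPoint F) (l : StarredLine F) : Prop :=
  (p : F × F) ∈ (l : AffineSubspace F (F × F))

/-- Incidence in `PG(2, F)`: points and lines are given by homogeneous coordinates. -/
def pgInc (F : Type*) [Field F] (p l : ℙ F (Fin 3 → F)) : Prop :=
  Projectivization.orthogonal p l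

/-- The points of `S`, with the lines that meet `S` in at least two points, form a projective
plane of order `n`. -/
structure IsSubplaneOfOrder {P L : Type*} (I : P → L → Prop) (S : Set P) (n : ℕ) : Prop where
  join : ∀ p ∈ S, ∀ p' ∈ S, p ≠ p' → ∃! l, I p l ∧ I p' l
  meet : ∀ l l' : L, l ≠ l' → 2 ≤ {p ∈ S | I p l}.ncard → 2 ≤ {p ∈ S | I p l'}.ncard →
    ∃! p, p ∈ S ∧ I p l ∧ I p l'
  card_line : ∀ l : L, 2 ≤ {p ∈ S | I p l}.ncard → {p ∈ S | I p l}.ncard = n + 1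
  quadrangle : ∃ x : Fin 4 → P, Function.Injective x ∧ (∀ i, x i ∈ S) ∧
    ∀ i j k, i ≠ j → i ≠ k → j ≠ k → ¬ ∃ l, I (x i) l ∧ I (x j) l ∧ I (x k) l

/-- The points with index congruent to `u` modulo `t`: an orbit of the subgroup of order `d` of the
cyclic group of order `t * d` that shifts the indices. -/
def orbitClass {P : Type*} (t d : ℕ) (e : ZMod (t * d) ≃ P) (u : ℕ) : Set P :=
  {p | ∃ b : ℕ, b < d ∧ p = e ((b * t + u : ℕ) : ZMod (t * d))}

/-- The rows `R` and columns `C` form an extending aggregate (E-aggregate) of `M = M(v, k)`: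
`k - 1` pairwise disjoint lines and `k - 1` pairwise non-collinear points whose critical submatrix
is a permutation matrix. -/
structure IsEAggregate {n : ℕ} (k : ℕ) (M : Matrix (Fin n) (Fin n) ℕ) (R C : Finset (Fin n)) :
    Prop where
  card_rows : R.card = k - 1
  card_cols : C.card = k - 1
  rows_disjoint : ∀ i ∈ R, ∀ i' ∈ R, i ≠ i' → ∀ j, ¬ (M i j = 1 ∧ M i' j = 1)
  cols_disjoint : ∀ j ∈ C, ∀ j' ∈ C, j ≠ j' → ∀ i, ¬ (M i j = 1 ∧ M i j' = 1)
  perm : ∃ π : R ≃ C, ∀ (i : R) (j : C), M i j = if π i = j then 1 else 0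

/-- Procedure E for the aggregate with rows `R` and columns `C`: a new last row and a new last
column are added, with a unit in the corner; the units of the critical submatrix are projected to
the new row and column and are then replaced by zeroes. -/
def procedureE {n : ℕ} (M : Matrix (Fin n) (Fin n) ℕ) (R C : Finset (Fin n)) :
    Matrix (Fin (n + 1)) (Fin (n + 1)) ℕ :=
  Matrix.of fun i j =>
    if hi : (i : ℕ) < n then
      if hj : (j : ℕ) < n then
        if (⟨i, hi⟩ : Fin n) ∈ R ∧ (⟨j, hj⟩ : Fin n) ∈ C then 0 else M ⟨i, hi⟩ ⟨j, hj⟩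
      else if (⟨i, hi⟩ : Fin n) ∈ R then 1 else 0
    else
      if hj : (j : ℕ) < n then (if (⟨j, hj⟩ : Fin n) ∈ C then 1 else 0) else 1

/-- `M'` arises from `M` by `θ` successive applications of Procedure E. -/
def IteratedE {n : ℕ} (k : ℕ) (M : Matrix (Fin n) (Fin n) ℕ) :
    (θ : ℕ) → Matrix (Fin (n + θ)) (Fin (n + θ)) ℕ → Prop
  | 0, M' => M' = M
  | θ + 1, M' => ∃ M₁ : Matrix (Fin (n + θ)) (Fin (n + θ)) ℕ, IteratedE k M θ M₁ ∧
      ∃ R C : Finset (Fin (n + θ)), IsEAggregate k M₁ R C ∧ M' = procedureE M₁ R C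

/-- `B` is obtained from the block matrix `A` by keeping the first `c` block rows and block columns
and dismissing some units. -/
def IsReduction {t d c : ℕ} (hc : c ≤ t) (A : Matrix (Fin t × Fin d) (Fin t × Fin d) ℕ)
    (B : Matrix (Fin c × Fin d) (Fin c × Fin d) ℕ) : Prop :=
  ∀ x y, B x y ≤ A (Fin.castLE hc x.1, x.2) (Fin.castLE hc y.1, y.2)

/-- From the block matrix `A` with blocks of size `d` one obtains an incidence matrix of a symmetric
configuration `v_k` with `v = c * d + θ`: first keep `c` block rows and columns and dismiss units so
that a block double-circulant incidence matrix of a configuration `(c * d)_k` with weights in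
`{0, 1}` results, then apply Procedure E `θ` times. -/
def YieldsConfig {t d : ℕ} (A : Matrix (Fin t × Fin d) (Fin t × Fin d) ℕ) (c θ k : ℕ) : Prop :=
  ∃ (hc : c ≤ t) (B : Matrix (Fin c × Fin d) (Fin c × Fin d) ℕ) (w : Fin c → ℕ)
    (M : Matrix (Fin (c * d + θ)) (Fin (c * d + θ)) ℕ),
    IsReduction hc A B ∧ IsBDC B w ∧ (∀ u, w u = 0 ∨ w u = 1) ∧ IsConfigMatrix B (c * d) k ∧
    IteratedE k (Matrix.reindex finProdFinEquiv finProdFinEquiv B) θ M ∧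
    IsConfigMatrix M (c * d + θ) k

/-! All the structures are developed from a modular Golomb ruler `S` in `ZMod (t * d)`: point `i`
lies on line `j` iff `i - j ∈ S`. A repeated nonzero difference would be the same as two lines
sharing two points. In the arranged matrix the entry at `(i, a)`, `(j, b)` depends only on `(j - i)
+ (b - a) * t`, so every block is circulant and its weight counts the elements of `S` congruent to
`j - i` modulo `t` (`isBDC_arranged`).

If the weights are positive, at least off the diagonal, then for `c ≤ t` one keeps `c` block rows
and columns, picks a set `U` of `k` residues modulo `c`, and retains a single cyclic permutation
matrix in each block with `j - i ∈ U`. Row and column sums become `k`, and the absence of rectangles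
is inherited (`IsBDC.yieldsConfig`). For a fixed `u ∈ U` the blocks `(i, i + u)` supply `c` disjoint
aggregates, because `k - 1 ≤ d`. Procedure E uses them one by one. The `c` lines and points added
meanwhile are pairwise disjoint and non-collinear, and they meet in a permutation matrix, so they
contain one further aggregate because `k - 1 ≤ c`. This is the source of the bound `c + 1`
(`exists_iteratedE`).

It remains to find the rulers and count their residues. For Ruzsa's ruler, `e_u` is `u` modulo `p -
1` and `-g ^ u` modulo `p`. For the starred plane, with `K` quadratic over `F` and `φ` a functional
with kernel `F`, `S` consists of the logarithms of the solutions of `φ x = 1`; the classes modulo `q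
+ 1` are the cosets of `Fˣ`, on each of which `φ` is zero or takes every nonzero value once. For
`PG(2, s ^ 2)`, with `K` cubic over `F`, `S` is the image of the kernel of a functional in the
cyclic group `Kˣ / Fˣ`. The classes modulo `t` are the multiples of the subfield `K₀` of order `s ^
3`, and `K₀ ∩ F` has order `s`, so they are Baer subplanes. A line meets each in `1` or `s + 1`
points, and counting its `s ^ 2 + 1` points leaves exactly one class with `s + 1`. -/

/-! ### Configurations through row and column sums. -/

theorem IsZeroOne.natCard_row {m n : Type*} [Fintype n] {M : Matrix m n ℕ} (h : IsZeroOne M)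
    (i : m) : Nat.card {j : n // M i j = 1} = ∑ j, M i j := by
  classical
  rw [Nat.card_eq_fintype_card, Fintype.card_subtype, Finset.card_filter]
  refine Finset.sum_congr rfl fun j _ => ?_
  rcases h i j with h | h <;> simp [h]

theorem IsZeroOne.transpose {m n : Type*} {M : Matrix m n ℕ} (h : IsZeroOne M) :
    IsZeroOne M.transpose := fun i j => h j i

/-- Incidence matrices of configurations in terms of row and column sums. -/
theorem isConfigMatrix_iff {n : Type*} [Fintype n] {M : Matrix n n ℕ} {v k : ℕ} :
    IsConfigMatrix M v k ↔ IsZeroOne M ∧ Fintype.card n = v ∧ (∀ l, ∑ p, M l p = k) ∧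
      (∀ p, ∑ l, M l p = k) ∧
      ∀ p p', p ≠ p' → ∀ l l', M l p = 1 → M l p' = 1 → M l' p = 1 → M l' p' = 1 → l = l' := by
  constructor
  · rintro ⟨h, hc⟩
    refine ⟨h, hc.card_points, fun l => ?_, fun p => ?_, hc.unique_line⟩
    · rw [← h.natCard_row]; exact hc.points_on_line l
    · rw [← hc.lines_through_point p]; exact (h.transpose.natCard_row p).symm
  · rintro ⟨h, hv, hr, hc, hu⟩
    refine ⟨h, hv, hv, fun l => ?_, fun p => ?_, hu⟩
    · rw [← hr l]; exact h.natCard_row l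
    · rw [← hc p]; exact h.transpose.natCard_row p

theorem IsConfigMatrix.transpose {n : Type*} [Fintype n] {M : Matrix n n ℕ} {v k : ℕ}
    (h : IsConfigMatrix M v k) : IsConfigMatrix M.transpose v k := by
  rw [isConfigMatrix_iff] at h ⊢
  obtain ⟨h, hv, hr, hc, hu⟩ := h
  refine ⟨h.transpose, hv, hc, hr, fun p p' hp l l' h1 h2 h3 h4 => ?_⟩
  by_contra hl
  exact hp (hu l l' hl p p' h1 h3 h2 h4)

theorem IsConfigMatrix.reindex {n m : Type*} [Fintype n] [Fintype m] {M : Matrix n n ℕ} {v k : ℕ}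
    (h : IsConfigMatrix M v k) (e : n ≃ m) : IsConfigMatrix (Matrix.reindex e e M) v k := by
  rw [isConfigMatrix_iff] at h ⊢
  obtain ⟨h, hv, hr, hc, hu⟩ := h
  refine ⟨fun i j => h _ _, by rw [← hv, Fintype.card_congr e], fun l => ?_, fun p => ?_,
    fun p p' hp l l' h1 h2 h3 h4 => ?_⟩
  · rw [← hr (e.symm l), ← e.symm.sum_comp]; rfl
  · rw [← hc (e.symm p), ← e.symm.sum_comp]; rfl
  · exact e.symm.injective (hu _ _ (e.symm.injective.ne hp) _ _ h1 h2 h3 h4)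

theorem IsConfigMatrix.existsSymmConfig {v k : ℕ} {M : Matrix (Fin v) (Fin v) ℕ}
    (h : IsConfigMatrix M v k) : ExistsSymmConfig v k := ⟨_, h.2⟩

/-! ### Procedure E and families of disjoint aggregates. -/

section ProcedureE

variable {n : ℕ} (M : Matrix (Fin n) (Fin n) ℕ) (R C : Finset (Fin n))

@[simp] theorem procedureE_castSucc_castSucc (i j : Fin n) :
    procedureE M R C i.castSucc j.castSucc = if i ∈ R ∧ j ∈ C then 0 else M i j := by
  simp [procedureE]

@[simp] theorem procedureE_castSucc_last (i : Fin n) :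
    procedureE M R C i.castSucc (Fin.last n) = if i ∈ R then 1 else 0 := by
  simp [procedureE]

@[simp] theorem procedureE_last_castSucc (j : Fin n) :
    procedureE M R C (Fin.last n) j.castSucc = if j ∈ C then 1 else 0 := by
  simp [procedureE]

@[simp] theorem procedureE_last_last :
    procedureE M R C (Fin.last n) (Fin.last n) = 1 := by
  simp [procedureE]

theorem transpose_procedureE :
    (procedureE M R C).transpose = procedureE M.transpose C R := by
  ext i j
  refine Fin.lastCases ?_ (fun i => ?_) i <;> refine Fin.lastCases ?_ (fun j => ?_) j <;>
    simp [and_comm]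

variable {M R C}

theorem IsEAggregate.transpose {k : ℕ} (h : IsEAggregate k M R C) :
    IsEAggregate k M.transpose C R := by
  obtain ⟨π, hπ⟩ := h.perm
  refine ⟨h.card_cols, h.card_rows, h.cols_disjoint, h.rows_disjoint, π.symm, fun j i => ?_⟩
  have hij : π.symm j = i ↔ π i = j := by rw [Equiv.symm_apply_eq, eq_comm]
  simp only [Matrix.transpose_apply, hπ, hij]

theorem IsZeroOne.procedureE (h : IsZeroOne M) : IsZeroOne (procedureE M R C) := by
  intro i j
  refine Fin.lastCases ?_ (fun i => ?_) i <;> refine Fin.lastCases ?_ (fun j => ?_) j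
  · simp
  · simp only [procedureE_last_castSucc]; split_ifs <;> simp
  · simp only [procedureE_castSucc_last]; split_ifs <;> simp
  · simp only [procedureE_castSucc_castSucc]; split_ifs
    · simp
    · exact h i j

/-- A chosen row loses its one critical unit and gains one in the new column. The new row has `(k -
1) + 1` units, which is `k` only for `0 < k`. -/
theorem IsEAggregate.sum_row_procedureE {k : ℕ} (hk : 0 < k) (h : IsEAggregate k M R C)
    (hM : ∀ l, ∑ p, M l p = k) (l : Fin (n + 1)) : ∑ p, _root_.procedureE M R C l p = k := by
  rw [Fin.sum_univ_castSucc]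
  refine Fin.lastCases ?_ (fun i => ?_) l
  · simp [h.card_cols]; omega
  · by_cases hi : i ∈ R
    · obtain ⟨π, hπ⟩ := h.perm
      have key : ∀ j, M i j = (if i ∈ R ∧ j ∈ C then 0 else M i j) +
          if j = (π ⟨i, hi⟩ : Fin n) then 1 else 0 := by
        intro j
        by_cases hj : j ∈ C
        · have := hπ ⟨i, hi⟩ ⟨j, hj⟩
          simp only [Subtype.ext_iff] at this
          simp [this, hi, hj, eq_comm]
        · have : j ≠ (π ⟨i, hi⟩ : Fin n) := fun h => hj (h ▸ (π ⟨i, hi⟩).2)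
          simp [hj, this]
      have h2 := hM i
      rw [Finset.sum_congr rfl fun j _ => key j, Finset.sum_add_distrib] at h2
      simpa [hi] using h2
    · simpa [hi] using hM i

/-- A rectangle through the new corner would need a surviving unit of the critical submatrix, but
these were erased. One using only the new row (column) would put two chosen columns (rows) on a
common old row (column). A rectangle of old entries was already present in `M`. -/
theorem IsEAggregate.unique_line_procedureE {k : ℕ} (h : IsEAggregate k M R C)
    (hu : ∀ p p', p ≠ p' → ∀ l l', M l p = 1 → M l p' = 1 → M l' p = 1 → M l' p' = 1 → l = l')
    (p p' : Fin (n + 1)) (hp : p ≠ p') (l l' : Fin (n + 1))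
    (h1 : _root_.procedureE M R C l p = 1) (h2 : _root_.procedureE M R C l p' = 1)
    (h3 : _root_.procedureE M R C l' p = 1) (h4 : _root_.procedureE M R C l' p' = 1) :
    l = l' := by
  by_contra hl
  have hr := h.rows_disjoint
  have hc := h.cols_disjoint
  have old : ∀ {i j}, (if i ∈ R ∧ j ∈ C then 0 else M i j) = 1 → M i j = 1 ∧ ¬ (i ∈ R ∧ j ∈ C) := by
    intro i j; split_ifs with h <;> simp_all
  have mem : ∀ {i : Fin n} {S : Finset (Fin n)}, (if i ∈ S then 1 else 0) = 1 → i ∈ S := by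
    intro i S; split_ifs <;> simp_all
  induction p using Fin.lastCases with
  | last =>
    induction p' using Fin.lastCases with
    | last => exact hp rfl
    | cast p' =>
      induction l using Fin.lastCases with
      | last =>
        induction l' using Fin.lastCases with
        | last => exact hl rfl
        | cast l' =>
          simp only [procedureE_last_castSucc, procedureE_castSucc_castSucc,
            procedureE_castSucc_last] at h1 h2 h3 h4
          exact (old h4).2 ⟨mem h3, mem h2⟩
      | cast l =>
        induction l' using Fin.lastCases with
        | last =>
          simp only [procedureE_last_castSucc, procedureE_castSucc_castSucc,
            procedureE_castSucc_last] at h1 h2 h3 h4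
          exact (old h2).2 ⟨mem h1, mem h4⟩
        | cast l' =>
          simp only [procedureE_castSucc_castSucc, procedureE_castSucc_last] at h1 h2 h3 h4
          exact hr _ (mem h1) _ (mem h3) (fun e => hl (congrArg _ e)) _ ⟨(old h2).1, (old h4).1⟩
  | cast p =>
    induction p' using Fin.lastCases with
    | last =>
      induction l using Fin.lastCases with
      | last =>
        induction l' using Fin.lastCases with
        | last => exact hl rfl
        | cast l' =>
          simp only [procedureE_last_castSucc, procedureE_castSucc_castSucc,
            procedureE_castSucc_last] at h1 h2 h3 h4
          exact (old h3).2 ⟨mem h4, mem h1⟩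
      | cast l =>
        induction l' using Fin.lastCases with
        | last =>
          simp only [procedureE_last_castSucc, procedureE_castSucc_castSucc,
            procedureE_castSucc_last] at h1 h2 h3 h4
          exact (old h1).2 ⟨mem h2, mem h3⟩
        | cast l' =>
          simp only [procedureE_castSucc_castSucc, procedureE_castSucc_last] at h1 h2 h3 h4
          exact hr _ (mem h2) _ (mem h4) (fun e => hl (congrArg _ e)) _ ⟨(old h1).1, (old h3).1⟩
    | cast p' =>
      have hp' : p ≠ p' := fun e => hp (congrArg _ e)
      induction l using Fin.lastCases with
      | last =>
        induction l' using Fin.lastCases with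
        | last => exact hl rfl
        | cast l' =>
          simp only [procedureE_last_castSucc, procedureE_castSucc_castSucc] at h1 h2 h3 h4
          exact hc _ (mem h1) _ (mem h2) hp' _ ⟨(old h3).1, (old h4).1⟩
      | cast l =>
        induction l' using Fin.lastCases with
        | last =>
          simp only [procedureE_last_castSucc, procedureE_castSucc_castSucc] at h1 h2 h3 h4
          exact hc _ (mem h3) _ (mem h4) hp' _ ⟨(old h1).1, (old h2).1⟩
        | cast l' =>
          simp only [procedureE_castSucc_castSucc] at h1 h2 h3 h4
          exact hl (congrArg _ (hu p p' hp' l l' (old h1).1 (old h2).1 (old h3).1 (old h4).1))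

/-- Procedure E turns the incidence matrix of a configuration `v_k` into one of a configuration
`(v + 1)_k`. -/
theorem IsEAggregate.isConfigMatrix_procedureE {k : ℕ} (hk : 0 < k) (h : IsEAggregate k M R C)
    (hM : IsConfigMatrix M n k) : IsConfigMatrix (_root_.procedureE M R C) (n + 1) k := by
  rw [isConfigMatrix_iff] at hM ⊢
  obtain ⟨h01, -, hr, hc, hu⟩ := hM
  refine ⟨h01.procedureE, by simp, h.sum_row_procedureE hk hr, fun p => ?_,
    h.unique_line_procedureE hu⟩
  have := h.transpose.sum_row_procedureE hk hc p
  rwa [← transpose_procedureE] at this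

/-- The lines `r a` are pairwise disjoint, the points `s a` are pairwise non-collinear, and the
only incidences between them are those of `r a` with `s a`. -/
structure EFamily {ι : Type*} [DecidableEq ι] (M : Matrix (Fin n) (Fin n) ℕ) (r s : ι → Fin n) :
    Prop where
  rows : ∀ a b, a ≠ b → ∀ j, ¬ (M (r a) j = 1 ∧ M (r b) j = 1)
  cols : ∀ a b, a ≠ b → ∀ i, ¬ (M i (s a) = 1 ∧ M i (s b) = 1)
  entry : ∀ a b, M (r a) (s b) = if a = b then 1 else 0

namespace EFamily

variable {ι κ : Type*} [DecidableEq ι] [DecidableEq κ] {r s : ι → Fin n}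

theorem injective_rows (h : EFamily M r s) : Function.Injective r := by
  intro a b hab
  by_contra hne
  exact h.rows a b hne (s a) ⟨by simp [h.entry], by simp [← hab, h.entry]⟩

theorem injective_cols (h : EFamily M r s) : Function.Injective s := by
  intro a b hab
  by_contra hne
  exact h.cols a b hne (r a) ⟨by simp [h.entry], by simp [← hab, h.entry]⟩

theorem comp (h : EFamily M r s) (f : κ ↪ ι) : EFamily M (r ∘ f) (s ∘ f) where
  rows a b hab := h.rows _ _ (f.injective.ne hab)
  cols a b hab := h.cols _ _ (f.injective.ne hab)
  entry a b := by simp [h.entry]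

theorem isEAggregate [Fintype ι] (h : EFamily M r s) {k : ℕ} (hk : Fintype.card ι = k - 1) :
    IsEAggregate k M (Finset.univ.image r) (Finset.univ.image s) where
  card_rows := by rw [Finset.card_image_of_injective _ h.injective_rows, Finset.card_univ, hk]
  card_cols := by rw [Finset.card_image_of_injective _ h.injective_cols, Finset.card_univ, hk]
  rows_disjoint := by
    simp only [Finset.mem_image, Finset.mem_univ, true_and]
    rintro _ ⟨a, rfl⟩ _ ⟨b, rfl⟩ hab
    exact h.rows a b fun e => hab (congrArg _ e)
  cols_disjoint := by
    simp only [Finset.mem_image, Finset.mem_univ, true_and]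
    rintro _ ⟨a, rfl⟩ _ ⟨b, rfl⟩ hab
    exact h.cols a b fun e => hab (congrArg _ e)
  perm := by
    have er : ∀ i : ↥(Finset.univ.image r), ∃ a, r a = i := fun i => by
      simpa only [Finset.mem_univ, true_and] using Finset.mem_image.1 i.2
    have es : ∀ i : ↥(Finset.univ.image s), ∃ a, s a = i := fun i => by
      simpa only [Finset.mem_univ, true_and] using Finset.mem_image.1 i.2
    choose f hf using er
    choose g hg using es
    have hfr : ∀ a h, f ⟨r a, h⟩ = a := fun a _ => h.injective_rows (hf _)
    have hgs : ∀ a h, g ⟨s a, h⟩ = a := fun a _ => h.injective_cols (hg _)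
    refine ⟨⟨fun i => ⟨s (f i), by simp⟩, fun j => ⟨r (g j), by simp⟩, fun i => ?_, fun j => ?_⟩,
      fun i j => ?_⟩
    · ext; simp [hgs, hf]
    · ext; simp [hfr, hg]
    · conv_lhs => rw [← hf i, ← hg j]
      rw [h.entry]
      simp only [Equiv.coe_fn_mk, Subtype.ext_iff]
      rw [← hg j]
      simp [h.injective_cols.eq_iff]

/-- A family of lines and points that avoids the aggregate survives Procedure E. -/
theorem procedureE (h : EFamily M r s) (hr : ∀ a, r a ∉ R) (hs : ∀ a, s a ∉ C) :
    EFamily (procedureE M R C) (fun a => (r a).castSucc) (fun a => (s a).castSucc) where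
  rows a b hab j := by
    refine Fin.lastCases ?_ (fun j => ?_) j
    · simp [hr]
    · simpa [hr] using h.rows a b hab j
  cols a b hab j := by
    refine Fin.lastCases ?_ (fun j => ?_) j
    · simp [hs]
    · simpa [hs] using h.cols a b hab j
  entry a b := by simp [hr, h.entry]

/-- The line and the point added by Procedure E extend a family which is not incident with the
aggregate. -/
theorem procedureE_snoc {m : ℕ} {r s : Fin m → Fin n} (h : EFamily M r s)
    (hr : ∀ a, r a ∉ R) (hs : ∀ a, s a ∉ C)
    (hrC : ∀ a, ∀ j ∈ C, M (r a) j = 0) (hsR : ∀ a, ∀ i ∈ R, M i (s a) = 0) :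
    EFamily (_root_.procedureE M R C)
      (Fin.snoc (α := fun _ => Fin (n + 1)) (fun a => (r a).castSucc) (Fin.last n))
      (Fin.snoc (α := fun _ => Fin (n + 1)) (fun a => (s a).castSucc) (Fin.last n)) := by
  have h' := h.procedureE hr hs
  refine ⟨fun a b => ?_, fun a b => ?_, fun a b => ?_⟩
  · refine Fin.lastCases ?_ (fun a => ?_) a <;> refine Fin.lastCases ?_ (fun b => ?_) b <;>
      intro hab j
    · exact absurd rfl hab
    · refine Fin.lastCases ?_ (fun j => ?_) j
      · simp [hr]
      · by_cases hj : j ∈ C <;> simp [hj, hr, hrC]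
    · refine Fin.lastCases ?_ (fun j => ?_) j
      · simp [hr]
      · by_cases hj : j ∈ C <;> simp [hj, hr, hrC]
    · simpa using h'.rows a b (fun e => hab (congrArg _ e)) j
  · refine Fin.lastCases ?_ (fun a => ?_) a <;> refine Fin.lastCases ?_ (fun b => ?_) b <;>
      intro hab j
    · exact absurd rfl hab
    · refine Fin.lastCases ?_ (fun j => ?_) j
      · simp [hs]
      · by_cases hj : j ∈ R <;> simp [hj, hs, hsR]
    · refine Fin.lastCases ?_ (fun j => ?_) j
      · simp [hs]
      · by_cases hj : j ∈ R <;> simp [hj, hs, hsR]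
    · simpa using h'.cols a b (fun e => hab (congrArg _ e)) j
  · refine Fin.lastCases ?_ (fun a => ?_) a <;> refine Fin.lastCases ?_ (fun b => ?_) b
    · simp
    · simp [hs, Fin.ext_iff, b.2.ne']
    · simp [hr, Fin.ext_iff, a.2.ne]
    · simpa [-procedureE_castSucc_castSucc] using h'.entry a b

end EFamily

/-- With `c` pairwise disjoint aggregates, Procedure E can be applied `c` times, once for each of
them, and one more time, to the lines and points added in the meantime. -/
theorem exists_iteratedE {k c : ℕ} (hk : 0 < k) (hkc : k - 1 ≤ c) (hM : IsConfigMatrix M n k)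
    (r s : Fin c → Fin (k - 1) → Fin n) (h : ∀ i, EFamily M (r i) (s i))
    (hr : ∀ i i', i ≠ i' → ∀ a a', r i a ≠ r i' a') (hs : ∀ i i', i ≠ i' → ∀ a a', s i a ≠ s i' a')
    (θ : ℕ) (hθ : θ ≤ c + 1) :
    ∃ M' : Matrix (Fin (n + θ)) (Fin (n + θ)) ℕ, IteratedE k M θ M' ∧
      IsConfigMatrix M' (n + θ) k := by
  -- The invariant after `θ` steps: the aggregates with index at least `θ` are intact, and the added
  -- lines and points `r'`, `s'` form a family of size `θ` with no incidence to those aggregates.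
  have key : ∀ θ ≤ c, ∃ M' : Matrix (Fin (n + θ)) (Fin (n + θ)) ℕ, IteratedE k M θ M' ∧
      IsConfigMatrix M' (n + θ) k ∧
      (∀ i : Fin c, θ ≤ i → EFamily M' (fun a => (r i a).castAdd θ) (fun a => (s i a).castAdd θ)) ∧
      ∃ r' s' : Fin θ → Fin (n + θ), EFamily M' r' s' ∧
        ∀ i : Fin c, θ ≤ i → ∀ a b, (r i a).castAdd θ ≠ r' b ∧ (s i a).castAdd θ ≠ s' b ∧
          M' ((r i a).castAdd θ) (s' b) = 0 ∧ M' (r' b) ((s i a).castAdd θ) = 0 := by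
    intro θ
    induction θ with
    | zero =>
      exact fun _ => ⟨M, rfl, hM, fun i _ => h i, Fin.elim0, Fin.elim0,
        ⟨fun a => a.elim0, fun a => a.elim0, fun a => a.elim0⟩, fun _ _ _ b => b.elim0⟩
    | succ θ ih =>
      intro hθ
      obtain ⟨M', hI, hC, hE, r', s', hE', hd⟩ := ih (by omega)
      let i₀ : Fin c := ⟨θ, hθ⟩
      have hagg := (hE i₀ le_rfl).isEAggregate (k := k) (by simp)
      set R := Finset.univ.image fun a => (r i₀ a).castAdd θ
      set C := Finset.univ.image fun a => (s i₀ a).castAdd θ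
      have hiR : ∀ i : Fin c, θ + 1 ≤ i → ∀ a, (r i a).castAdd θ ∉ R := by
        intro i hi a hmem
        obtain ⟨b, -, hb⟩ := Finset.mem_image.1 hmem
        exact hr i₀ i (by rintro rfl; simp [i₀] at hi) b a (Fin.castAdd_injective n θ hb)
      have hiC : ∀ i : Fin c, θ + 1 ≤ i → ∀ a, (s i a).castAdd θ ∉ C := by
        intro i hi a hmem
        obtain ⟨b, -, hb⟩ := Finset.mem_image.1 hmem
        exact hs i₀ i (by rintro rfl; simp [i₀] at hi) b a (Fin.castAdd_injective n θ hb)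
      have hr'R : ∀ b, r' b ∉ R := by
        intro b hmem
        obtain ⟨a, -, ha⟩ := Finset.mem_image.1 hmem
        exact (hd i₀ le_rfl a b).1 ha
      have hs'C : ∀ b, s' b ∉ C := by
        intro b hmem
        obtain ⟨a, -, ha⟩ := Finset.mem_image.1 hmem
        exact (hd i₀ le_rfl a b).2.1 ha
      refine ⟨procedureE M' R C, ⟨M', hI, R, C, hagg, rfl⟩, hagg.isConfigMatrix_procedureE hk hC,
        fun i hi => (hE i (by omega)).procedureE (hiR i hi) (hiC i hi), _, _,
        hE'.procedureE_snoc hr'R hs'C ?_ ?_, ?_⟩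
      · intro b j hj
        obtain ⟨a, -, rfl⟩ := Finset.mem_image.1 hj
        exact (hd i₀ le_rfl a b).2.2.2
      · intro b j hj
        obtain ⟨a, -, rfl⟩ := Finset.mem_image.1 hj
        exact (hd i₀ le_rfl a b).2.2.1
      · intro i hi a b
        have e1 : (r i a).castAdd (θ + 1) = ((r i a).castAdd θ).castSucc := rfl
        have e2 : (s i a).castAdd (θ + 1) = ((s i a).castAdd θ).castSucc := rfl
        rw [e1, e2]
        refine Fin.lastCases ?_ (fun b => ?_) b
        · simp [hiR i hi, hiC i hi, Fin.castSucc_ne_last]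
        · obtain ⟨h1, h2, h3, h4⟩ := hd i (by omega) a b
          simp [h1, h2, h3, h4]
  rcases Nat.lt_or_ge c θ with hlt | hle
  · obtain rfl : θ = c + 1 := by omega
    obtain ⟨M', hI, hC, -, r', s', hE, -⟩ := key c le_rfl
    have hagg := (hE.comp (Fin.castLEEmb hkc)).isEAggregate (k := k) (by simp)
    exact ⟨_, ⟨M', hI, _, _, hagg, rfl⟩, hagg.isConfigMatrix_procedureE hk hC⟩
  · obtain ⟨M', hI, hC, -⟩ := key θ hle
    exact ⟨M', hI, hC⟩

end ProcedureE

/-! ### Cyclic permutation matrices inside circulant blocks. -/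

/-- A unit of a circulant block propagates along its whole cyclic diagonal. -/
theorem IsBDC.exists_shift {t d : ℕ} [NeZero d] {A : Matrix (Fin t × Fin d) (Fin t × Fin d) ℕ}
    {w : Fin t → ℕ} (hA : IsBDC A w) {i j : Fin t} (h : w (j - i) ≠ 0) :
    ∃ τ : Fin d, ∀ a, A (i, a) (j, a + τ) = 1 := by
  obtain ⟨⟨u, hu⟩, hs⟩ := hA.2 i j
  obtain ⟨b, -, hb⟩ := Finset.exists_ne_zero_of_sum_ne_zero (hs 0 ▸ h)
  have hA' : ∀ a b, A (i, a) (j, b) = u (a - b) := fun a b => congrFun (congrFun hu a) b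
  refine ⟨b, fun a => (hA.1 _ _).resolve_left ?_⟩
  rw [hA', show a - (a + b) = 0 - b by abel, ← hA']
  exact hb

/-- The block matrix with a cyclic permutation matrix in the block positions `(i, j)` with
`j - i ∈ U`; its shift is `τ i j`. -/
def shiftMatrix {c d : ℕ} (U : Finset (Fin c)) (τ : Fin c → Fin c → Fin d) :
    Matrix (Fin c × Fin d) (Fin c × Fin d) ℕ :=
  Matrix.of fun x y => if y.1 - x.1 ∈ U ∧ y.2 = x.2 + τ x.1 y.1 then 1 else 0

section ShiftMatrix

variable {c d : ℕ} {U : Finset (Fin c)} {τ : Fin c → Fin c → Fin d}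

theorem shiftMatrix_eq_one {x y} :
    shiftMatrix U τ x y = 1 ↔ y.1 - x.1 ∈ U ∧ y.2 = x.2 + τ x.1 y.1 := by
  simp [shiftMatrix]

theorem isZeroOne_shiftMatrix : IsZeroOne (shiftMatrix U τ) := by
  intro x y
  simp only [shiftMatrix, Matrix.of_apply]
  split_ifs <;> simp

theorem isBDC_shiftMatrix [NeZero d] :
    IsBDC (shiftMatrix U τ) fun u => if u ∈ U then 1 else 0 := by
  refine ⟨isZeroOne_shiftMatrix, fun i j => ⟨⟨fun e => if j - i ∈ U ∧ -e = τ i j then 1 else 0, ?_⟩,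
    fun a => ?_⟩⟩
  · ext a b
    have : b = a + τ i j ↔ -(a - b) = τ i j := by
      rw [neg_sub, sub_eq_iff_eq_add, add_comm]
    simp [block, shiftMatrix, this]
  · by_cases h : j - i ∈ U <;> simp [block, shiftMatrix, h]

/-- For fixed `i`, the map `j ↦ j - i` permutes the block indices, so a row meets exactly `U.card`
nonzero blocks, with one unit in each; columns are dual. Only the absence of rectangles has to be
assumed. -/
theorem isConfigMatrix_shiftMatrix [NeZero c] [NeZero d]
    (hu : ∀ p p', p ≠ p' → ∀ l l', shiftMatrix U τ l p = 1 → shiftMatrix U τ l p' = 1 →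
      shiftMatrix U τ l' p = 1 → shiftMatrix U τ l' p' = 1 → l = l') :
    IsConfigMatrix (shiftMatrix U τ) (c * d) U.card := by
  refine isConfigMatrix_iff.2 ⟨isZeroOne_shiftMatrix, by simp, fun x => ?_, fun y => ?_, hu⟩
  · have : ∀ j, ∑ b, shiftMatrix U τ x (j, b) = if j - x.1 ∈ U then 1 else 0 := fun j => by
      by_cases h : j - x.1 ∈ U <;> simp [shiftMatrix, h]
    rw [Fintype.sum_prod_type, Finset.sum_congr rfl fun j _ => this j]
    exact ((Equiv.subRight x.1).sum_comp fun j => if j ∈ U then 1 else 0).trans (by simp)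
  · have : ∀ i, ∑ a, shiftMatrix U τ (i, a) y = if y.1 - i ∈ U then 1 else 0 := fun i => by
      have e : ∀ a, y.2 = a + τ i y.1 ↔ a = y.2 - τ i y.1 := fun a => by
        rw [eq_sub_iff_add_eq, eq_comm]
      by_cases h : y.1 - i ∈ U <;> simp [shiftMatrix, h, e]
    rw [Fintype.sum_prod_type, Finset.sum_congr rfl fun j _ => this j]
    exact ((Equiv.subLeft y.1).sum_comp fun j => if j ∈ U then 1 else 0).trans (by simp)

/-- The lines of block row `i` and the points of block column `i + u`. -/
theorem eFamily_shiftMatrix [NeZero c] [NeZero d] {ι : Type*} [DecidableEq ι] {u : Fin c}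
    (hu : u ∈ U) (i : Fin c) {f : ι → Fin d} (hf : Function.Injective f) :
    EFamily (Matrix.reindex finProdFinEquiv finProdFinEquiv (shiftMatrix U τ))
      (fun a => finProdFinEquiv (i, f a))
      (fun a => finProdFinEquiv (i + u, f a + τ i (i + u))) where
  rows a b hab j h := by
    simp only [Matrix.reindex_apply, Matrix.submatrix_apply, Equiv.symm_apply_apply,
      shiftMatrix_eq_one] at h
    exact hab (hf (add_right_cancel (h.1.2.symm.trans h.2.2)))
  cols a b hab j h := by
    simp only [Matrix.reindex_apply, Matrix.submatrix_apply, Equiv.symm_apply_apply,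
      shiftMatrix_eq_one] at h
    exact hab (hf (add_right_cancel (h.1.2.trans h.2.2.symm)))
  entry a b := by
    simp [shiftMatrix, hu, hf.eq_iff, eq_comm]

end ShiftMatrix

/-- In `hw`, `j - i ∈ U` is a difference modulo `c`, while the argument of `w` is a difference
modulo `t`. A block diagonal modulo `c` thus combines blocks of different weights of `A`, and all
that matters is that none of them is zero. -/
theorem IsBDC.yieldsConfig {t d : ℕ} [NeZero d] {A : Matrix (Fin t × Fin d) (Fin t × Fin d) ℕ}
    {w : Fin t → ℕ} (hA : IsBDC A w)
    (hA' : ∀ p p', p ≠ p' → ∀ l l', A l p = 1 → A l p' = 1 → A l' p = 1 → A l' p' = 1 → l = l')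
    {c θ : ℕ} [NeZero c] (hc : c ≤ t) (hθ : θ ≤ c + 1) {U : Finset (Fin c)} (hU : U.Nonempty)
    (hUd : U.card - 1 ≤ d)
    (hw : ∀ i j : Fin c, j - i ∈ U → w (Fin.castLE hc j - Fin.castLE hc i) ≠ 0) :
    YieldsConfig A c θ U.card := by
  have : ∀ i j : Fin c, ∃ τ : Fin d, j - i ∈ U →
      ∀ a, A (Fin.castLE hc i, a) (Fin.castLE hc j, a + τ) = 1 := by
    intro i j
    by_cases h : j - i ∈ U
    · obtain ⟨τ, hτ⟩ := hA.exists_shift (hw i j h)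
      exact ⟨τ, fun _ => hτ⟩
    · exact ⟨0, fun h' => absurd h' h⟩
  choose τ hτ using this
  have hle : ∀ x y, shiftMatrix U τ x y = 1 →
      A (Fin.castLE hc x.1, x.2) (Fin.castLE hc y.1, y.2) = 1 := by
    intro x y h
    rw [shiftMatrix_eq_one] at h
    rw [h.2]
    exact hτ _ _ h.1 _
  have hinj : Function.Injective fun x : Fin c × Fin d => (Fin.castLE hc x.1, x.2) := by
    rintro ⟨x, a⟩ ⟨y, b⟩ h
    simpa using h
  have hconf : IsConfigMatrix (shiftMatrix U τ) (c * d) U.card :=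
    isConfigMatrix_shiftMatrix fun p p' hp l l' h1 h2 h3 h4 => hinj
      (hA' _ _ (hinj.ne hp) _ _ (hle _ _ h1) (hle _ _ h2) (hle _ _ h3) (hle _ _ h4))
  obtain ⟨u, hu⟩ := hU
  have hUc : U.card ≤ c := by simpa using U.card_le_univ
  -- One `u ∈ U` serves all aggregates: the `i`-th lies in block row `i` and block column `i + u`,
  -- so different ones share no row or column.
  obtain ⟨M, hM, hM'⟩ := exists_iteratedE (Finset.card_pos.2 ⟨u, hu⟩) (by omega)
    (hconf.reindex finProdFinEquiv) _ _
    (fun i => eFamily_shiftMatrix hu i (Fin.castLE_injective hUd))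
    (fun i i' hi a a' h => hi (by simpa using congrArg Prod.fst (finProdFinEquiv.injective h)))
    (fun i i' hi a a' h => hi (by simpa using congrArg Prod.fst (finProdFinEquiv.injective h)))
    θ hθ
  refine ⟨hc, shiftMatrix U τ, _, M, fun x y => ?_, isBDC_shiftMatrix, fun u => ?_, hconf, hM, hM'⟩
  · rcases isZeroOne_shiftMatrix (U := U) (τ := τ) x y with h | h
    · simp [h]
    · rw [h, hle x y h]
  · split_ifs <;> simp

/-- A block double-circulant matrix all of whose weights are positive. -/
theorem IsBDC.yieldsConfig_of_pos {t d : ℕ} [NeZero d]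
    {A : Matrix (Fin t × Fin d) (Fin t × Fin d) ℕ} {w : Fin t → ℕ} (hA : IsBDC A w)
    (hA' : ∀ p p', p ≠ p' → ∀ l l', A l p = 1 → A l p' = 1 → A l' p = 1 → A l' p' = 1 → l = l')
    (hw : ∀ u, w u ≠ 0) {c θ k : ℕ} (hc : c ≤ t) (hθ : θ ≤ c + 1) (hk : 0 < k) (hkc : k ≤ c)
    (hkd : k - 1 ≤ d) : YieldsConfig A c θ k := by
  have : NeZero c := ⟨by omega⟩
  obtain ⟨U, -, hU⟩ := Finset.exists_subset_card_eq (s := (Finset.univ : Finset (Fin c)))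
    (n := k) (by simpa using hkc)
  subst hU
  exact hA.yieldsConfig hA' hc hθ (Finset.card_pos.1 hk) hkd fun _ _ _ => hw _

/-- A block double-circulant matrix all of whose weights outside the main diagonal are positive. -/
theorem IsBDC.yieldsConfig_of_pos_of_ne {t d : ℕ} [NeZero d]
    {A : Matrix (Fin t × Fin d) (Fin t × Fin d) ℕ} {w : Fin t → ℕ} (hA : IsBDC A w)
    (hA' : ∀ p p', p ≠ p' → ∀ l l', A l p = 1 → A l p' = 1 → A l' p = 1 → A l' p' = 1 → l = l')
    (hw : ∀ u : Fin t, (u : ℕ) ≠ 0 → w u ≠ 0) {c θ k : ℕ} (hc : c ≤ t) (hθ : θ ≤ c + 1) (hk : 0 < k)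
    (hkc : k ≤ c - 1) (hkd : k - 1 ≤ d) : YieldsConfig A c θ k := by
  have : NeZero c := ⟨by omega⟩
  have : NeZero t := ⟨by omega⟩
  -- Excluding `0` from `U` avoids the diagonal blocks, the only ones that may vanish.
  obtain ⟨U, hU0, hU⟩ := Finset.exists_subset_card_eq
    (s := (Finset.univ.erase 0 : Finset (Fin c))) (n := k) (by simpa using hkc)
  subst hU
  refine hA.yieldsConfig hA' hc hθ (Finset.card_pos.1 hk) hkd fun i j hij => hw _ fun h => ?_
  have hne : j - i ≠ 0 := Finset.ne_of_mem_erase (hU0 hij)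
  have h0 : Fin.castLE hc j - Fin.castLE hc i = 0 := Fin.ext h
  exact hne (sub_eq_zero.2 (Fin.castLE_injective hc (sub_eq_zero.1 h0)))

theorem YieldsConfig.existsSymmConfig {t d : ℕ} {A : Matrix (Fin t × Fin d) (Fin t × Fin d) ℕ}
    {c θ k : ℕ} (h : YieldsConfig A c θ k) : ExistsSymmConfig (c * d + θ) k := by
  obtain ⟨-, -, -, M, -, -, -, -, -, hM⟩ := h
  exact hM.existsSymmConfig

/-! ### Matrices developed from modular Golomb rulers. -/

section Arranged

variable {t d : ℕ} {S : Finset (ZMod (t * d))}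

/-- The residue modulo `t * d` in position `x` of the arranged matrix. -/
def position (x : Fin t × Fin d) : ZMod (t * d) := ((x.2 : ℕ) * t + (x.1 : ℕ) : ℕ)

theorem position_injective : Function.Injective (position : Fin t × Fin d → ZMod (t * d)) := by
  rintro ⟨i, a⟩ ⟨j, b⟩ h
  have hlt : ∀ x : Fin t × Fin d, (x.2 : ℕ) * t + (x.1 : ℕ) < t * d := by
    rintro ⟨⟨i, hi⟩, ⟨a, ha⟩⟩
    simp only
    nlinarith
  have ht : 0 < t := i.pos
  rw [position, position, ZMod.natCast_eq_natCast_iff', Nat.mod_eq_of_lt (hlt _),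
    Nat.mod_eq_of_lt (hlt _)] at h
  simp only at h
  have h1 := congrArg (· % t) h
  have h2 := congrArg (· / t) h
  simp only [Nat.mul_add_mod_self_right, Nat.mod_eq_of_lt i.2, Nat.mod_eq_of_lt j.2] at h1
  simp only [Nat.mul_comm _ t, Nat.mul_add_div ht, Nat.div_eq_of_lt i.2, Nat.div_eq_of_lt j.2,
    add_zero] at h2
  exact Prod.ext (Fin.ext h1) (Fin.ext h2)

theorem castHom_position (x : Fin t × Fin d) :
    ZMod.castHom (dvd_mul_right t d) (ZMod t) (position x) = ((x.1 : ℕ) : ZMod t) := by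
  rw [position, map_natCast]
  simp

theorem arranged_sub_apply (x y : Fin t × Fin d) :
    arranged t d (fun i j => i - j ∈ S) x y = if position y - position x ∈ S then 1 else 0 := by
  simp only [arranged, Matrix.of_apply, position]
  congr

theorem isZeroOne_arranged {J : ZMod (t * d) → ZMod (t * d) → Prop} :
    IsZeroOne (arranged t d J) := by
  intro x y
  simp only [arranged, Matrix.of_apply]
  split_ifs <;> simp

theorem ZMod.natCast_fin_sub (i j : Fin t) :
    (((j - i : Fin t) : ℕ) : ZMod t) = ((j : ℕ) : ZMod t) - ((i : ℕ) : ZMod t) := by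
  rw [Fin.sub_def]
  simp [Nat.cast_sub i.2.le]
  ring

theorem ZMod.natCast_fin_injective : Function.Injective fun i : Fin t => ((i : ℕ) : ZMod t) := by
  intro i j h
  simp only [ZMod.natCast_eq_natCast_iff', Nat.mod_eq_of_lt i.2, Nat.mod_eq_of_lt j.2] at h
  exact Fin.ext h

/-- Two points on two common lines give `(p - l) - (p' - l) = (p - l') - (p' - l')`, a nonzero
difference represented twice. -/
theorem IsModularGolombRuler.eq_of_sub_mem {v k : ℕ} {S : Finset (ZMod v)}
    (hS : IsModularGolombRuler v k S) {p p' l l' : ZMod v} (hp : p ≠ p') (h1 : p - l ∈ S)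
    (h2 : p' - l ∈ S) (h3 : p - l' ∈ S) (h4 : p' - l' ∈ S) : l = l' := by
  have := (hS.2 _ h1 _ h2 _ h3 _ h4 (fun h => hp (sub_left_injective h))
    (fun h => hp (sub_left_injective h)) (by ring)).1
  simpa using this

theorem IsModularGolombRuler.unique_line_arranged {k : ℕ}
    (hS : IsModularGolombRuler (t * d) k S) (p p' : Fin t × Fin d) (hp : p ≠ p')
    (l l' : Fin t × Fin d)
    (h1 : arranged t d (fun i j => i - j ∈ S) l p = 1)
    (h2 : arranged t d (fun i j => i - j ∈ S) l p' = 1)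
    (h3 : arranged t d (fun i j => i - j ∈ S) l' p = 1)
    (h4 : arranged t d (fun i j => i - j ∈ S) l' p' = 1) : l = l' := by
  simp only [arranged_sub_apply, ite_eq_left_iff, zero_ne_one, imp_false, not_not] at h1 h2 h3 h4
  exact position_injective
    (hS.eq_of_sub_mem (position_injective.ne hp) h1 h2 h3 h4)

variable [NeZero t] [NeZero d]

theorem position_bijective : Function.Bijective (position : Fin t × Fin d → ZMod (t * d)) :=
  (Fintype.bijective_iff_injective_and_card _).2 ⟨position_injective, by simp [ZMod.card]⟩

theorem IsModularGolombRuler.isConfigMatrix_arranged {k : ℕ}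
    (hS : IsModularGolombRuler (t * d) k S) :
    IsConfigMatrix (arranged t d fun i j => i - j ∈ S) (t * d) k := by
  refine isConfigMatrix_iff.2 ⟨isZeroOne_arranged, by simp, fun x => ?_, fun y => ?_,
    hS.unique_line_arranged⟩
  · simp only [arranged_sub_apply]
    refine (position_bijective.sum_comp fun z => if z - position x ∈ S then 1 else 0).trans ?_
    refine ((Equiv.subRight (position x)).sum_comp fun z => if z ∈ S then 1 else 0).trans ?_
    simp [hS.1]
  · simp only [arranged_sub_apply]
    refine (position_bijective.sum_comp fun z => if position y - z ∈ S then 1 else 0).trans ?_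
    refine ((Equiv.subLeft (position y)).sum_comp fun z => if z ∈ S then 1 else 0).trans ?_
    simp [hS.1]

/-- The weights of the arranged matrix of a ruler count its residues modulo `t`. -/
theorem isBDC_arranged {w : Fin t → ℕ}
    (hw : ∀ u : Fin t, (S.filter fun s =>
      ZMod.castHom (dvd_mul_right t d) (ZMod t) s = ((u : ℕ) : ZMod t)).card = w u) :
    IsBDC (arranged t d fun i j => i - j ∈ S) w := by
  refine ⟨isZeroOne_arranged, fun i j => ⟨⟨fun e => if
    ((j : ℕ) : ZMod (t * d)) - (i : ℕ) - ((e : ℕ) : ZMod (t * d)) * t ∈ S then 1 else 0, ?_⟩,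
    fun a => ?_⟩⟩
  · ext a b
    -- Subtraction in `Fin d` differs from integer subtraction by a multiple of `d`, which is
    -- invisible after multiplication by `t` modulo `t * d`.
    have key : position (j, b) - position (i, a) =
        ((j : ℕ) : ZMod (t * d)) - (i : ℕ) - (((a - b : Fin d) : ℕ) : ZMod (t * d)) * t := by
      have h1 : (((a - b : Fin d) : ℕ) : ZMod d) = ((a : ℕ) : ZMod d) - ((b : ℕ) : ZMod d) :=
        ZMod.natCast_fin_sub b a
      have h2 : ((((a - b : Fin d) : ℕ) : ℤ) : ZMod d) = ((((a : ℕ) : ℤ) - ((b : ℕ) : ℤ) : ℤ) :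
        ZMod d) := by push_cast; exact h1
      rw [ZMod.intCast_eq_intCast_iff_dvd_sub] at h2
      obtain ⟨m, hm⟩ := h2
      have h3 : (((((a : ℕ) : ℤ) - ((b : ℕ) : ℤ) - ((a - b : Fin d) : ℕ)) * t : ℤ) :
          ZMod (t * d)) = 0 := by
        rw [ZMod.intCast_zmod_eq_zero_iff_dvd, hm]
        exact ⟨m, by push_cast; ring⟩
      push_cast at h3
      simp only [position]
      push_cast
      linear_combination -h3
    simp [block, arranged_sub_apply, key]
  · simp only [block, Matrix.of_apply, arranged_sub_apply]
    rw [← hw, ← Finset.card_filter]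
    -- As `b` varies, the differences of positions run once through the residue class of `j - i`
    -- modulo `t`.
    refine Finset.card_nbij (fun b => position (j, b) - position (i, a)) ?_ ?_ ?_
    · intro b hb
      simp only [Finset.coe_filter, Finset.mem_univ, true_and, Set.mem_ofPred_eq] at hb ⊢
      exact ⟨hb, by rw [map_sub, castHom_position, castHom_position, ZMod.natCast_fin_sub]⟩
    · intro b _ b' _ h
      have := position_injective (sub_left_injective h)
      simpa using this
    · intro s hs
      simp only [Finset.coe_filter, Set.mem_ofPred_eq] at hs
      obtain ⟨⟨j', b⟩, hy⟩ := position_bijective.2 (s + position (i, a))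
      have hj : j' = j := by
        apply ZMod.natCast_fin_injective
        have := congrArg (ZMod.castHom (dvd_mul_right t d) (ZMod t)) hy
        rw [map_add, castHom_position, castHom_position, hs.2, ZMod.natCast_fin_sub] at this
        simpa using this
      subst hj
      refine ⟨b, ?_, ?_⟩
      · simpa [hy] using hs.1
      · simp [hy]

end Arranged

/-- An incidence structure which is developed from a modular Golomb ruler. -/
theorem IsModularGolombRuler.isSymmConfig {P L : Type*} [Fintype P] [Fintype L] {I : P → L → Prop}
    {v k : ℕ} [NeZero v] {S : Finset (ZMod v)} (hS : IsModularGolombRuler v k S)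
    (e : ZMod v ≃ P) (f : ZMod v ≃ L) (h : ∀ i j, I (e i) (f j) ↔ i - j ∈ S) :
    IsSymmConfig I v k where
  card_points := by rw [← Fintype.card_congr e, ZMod.card]
  card_lines := by rw [← Fintype.card_congr f, ZMod.card]
  points_on_line l := by
    obtain ⟨j, rfl⟩ := f.surjective l
    rw [← hS.1, ← Nat.card_eq_finsetCard, ← Nat.card_congr (e.subtypeEquiv fun i => (h i j).symm)]
    exact Nat.card_congr ((Equiv.subRight j).subtypeEquiv fun i => by simp)
  lines_through_point p := by
    obtain ⟨i, rfl⟩ := e.surjective p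
    rw [← hS.1, ← Nat.card_eq_finsetCard, ← Nat.card_congr (f.subtypeEquiv fun j => (h i j).symm)]
    exact Nat.card_congr ((Equiv.subLeft i).subtypeEquiv fun i => by simp)
  unique_line p p' hp l l' := by
    obtain ⟨i, rfl⟩ := e.surjective p
    obtain ⟨i', rfl⟩ := e.surjective p'
    obtain ⟨j, rfl⟩ := f.surjective l
    obtain ⟨j', rfl⟩ := f.surjective l'
    simp only [h]
    intro h1 h2 h3 h4
    rw [hS.eq_of_sub_mem (fun he => hp (congrArg e he)) h1 h2 h3 h4]

/-! ### Ruzsa's ruler. -/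

section Ruzsa

/-- The element with parameter `u` of Ruzsa's ruler. -/
def ruzsaElement (p g v u : ℕ) : ZMod v := ((p * u + (p - 1) * g ^ u : ℕ) : ZMod v)

theorem mem_ruzsa {p g v : ℕ} {x : ZMod v} :
    x ∈ ruzsa p g v ↔ ∃ u, (1 ≤ u ∧ u ≤ p - 1) ∧ ruzsaElement p g v u = x := by
  simp [ruzsa, ruzsaElement]

/-- The range `1, …, n` is used, with `n` in the role of `0`, to match the parameters of the ruler.
-/
theorem eq_of_natCast_eq_of_le {n u u' : ℕ} (hu : 1 ≤ u ∧ u ≤ n) (hu' : 1 ≤ u' ∧ u' ≤ n)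
    (h : (u : ZMod n) = u') : u = u' := by
  rw [ZMod.natCast_eq_natCast_iff] at h
  refine h.eq_of_abs_lt ?_
  rw [abs_lt]
  omega

theorem exists_natCast_eq_of_le {n : ℕ} [NeZero n] (w : ZMod n) :
    ∃ u : ℕ, (1 ≤ u ∧ u ≤ n) ∧ (u : ZMod n) = w := by
  by_cases h : w.val = 0
  · exact ⟨n, ⟨NeZero.one_le, le_rfl⟩, by rw [ZMod.natCast_self, eq_comm, ← ZMod.val_eq_zero, h]⟩
  · exact ⟨w.val, ⟨by omega, w.val_lt.le⟩, ZMod.natCast_zmod_val w⟩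

variable {p g v : ℕ} [hp : Fact p.Prime]

/-- Because `p` is `1` and `p - 1` is `0` modulo `p - 1`. -/
theorem castHom_sub_one_ruzsaElement (hv : p - 1 ∣ v) (u : ℕ) :
    ZMod.castHom hv (ZMod (p - 1)) (ruzsaElement p g v u) = u := by
  have h : ((p : ℕ) : ZMod (p - 1)) = 1 := by
    have h : ((p - 1 + 1 : ℕ) : ZMod (p - 1)) = 1 := by
      rw [Nat.cast_add, ZMod.natCast_self, zero_add, Nat.cast_one]
    rwa [Nat.sub_add_cancel hp.out.one_le] at h
  rw [ruzsaElement, map_natCast, Nat.cast_add, Nat.cast_mul, Nat.cast_mul, h, ZMod.natCast_self]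
  ring

/-- Because `p` is `0` and `p - 1` is `-1` modulo `p`. -/
theorem castHom_ruzsaElement (hv : p ∣ v) (u : ℕ) :
    ZMod.castHom hv (ZMod p) (ruzsaElement p g v u) = -(g : ZMod p) ^ u := by
  rw [ruzsaElement, map_natCast, Nat.cast_add, Nat.cast_mul, Nat.cast_mul, ZMod.natCast_self,
    Nat.cast_sub hp.out.one_le]
  simp

theorem pow_eq_pow_iff_natCast_eq (hg : orderOf (g : ZMod p) = p - 1) {u u' : ℕ} :
    (g : ZMod p) ^ u = (g : ZMod p) ^ u' ↔ (u : ZMod (p - 1)) = u' := by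
  have : IsOfFinOrder (g : ZMod p) :=
    orderOf_pos_iff.1 (hg ▸ Nat.sub_pos_of_lt hp.out.one_lt)
  rw [this.pow_eq_pow_iff_modEq, hg, ZMod.natCast_eq_natCast_iff]

theorem natCast_ne_zero_of_orderOf (hg : orderOf (g : ZMod p) = p - 1) : (g : ZMod p) ≠ 0 := by
  intro h
  have h1 := pow_orderOf_eq_one (g : ZMod p)
  have := hp.out.two_le
  rw [hg, h, zero_pow (by omega)] at h1
  exact zero_ne_one h1

theorem exists_pow_eq_of_ne_zero (hg : orderOf (g : ZMod p) = p - 1) {x : ZMod p} (hx : x ≠ 0) :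
    ∃ u, (1 ≤ u ∧ u ≤ p - 1) ∧ (g : ZMod p) ^ u = x := by
  have hsub : (Finset.Icc 1 (p - 1)).image (fun u => (g : ZMod p) ^ u) ⊆ Finset.univ.erase 0 := by
    intro y hy
    obtain ⟨u, -, rfl⟩ := Finset.mem_image.1 hy
    exact Finset.mem_erase.2 ⟨pow_ne_zero _ (natCast_ne_zero_of_orderOf hg), Finset.mem_univ _⟩
  have heq := Finset.eq_of_subset_of_card_le hsub (by
    rw [Finset.card_image_of_injOn, Finset.card_erase_of_mem (Finset.mem_univ _), Finset.card_univ,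
      ZMod.card, Nat.card_Icc]
    · omega
    · intro u hu u' hu' h
      exact eq_of_natCast_eq_of_le (Finset.mem_Icc.1 hu) (Finset.mem_Icc.1 hu')
        ((pow_eq_pow_iff_natCast_eq hg).1 h))
  have : x ∈ (Finset.Icc 1 (p - 1)).image fun u => (g : ZMod p) ^ u :=
    heq ▸ Finset.mem_erase.2 ⟨hx, Finset.mem_univ _⟩
  simpa using this

/-- Ruzsa's ruler. -/
theorem isModularGolombRuler_ruzsa (hg : orderOf (g : ZMod p) = p - 1) (hv : p ∣ v)
    (hv' : p - 1 ∣ v) : IsModularGolombRuler v (p - 1) (ruzsa p g v) := by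
  have inj : ∀ {u u' : ℕ}, (1 ≤ u ∧ u ≤ p - 1) → (1 ≤ u' ∧ u' ≤ p - 1) →
      (g : ZMod p) ^ u = (g : ZMod p) ^ u' → u = u' := fun hu hu' h =>
    eq_of_natCast_eq_of_le hu hu' ((pow_eq_pow_iff_natCast_eq hg).1 h)
  constructor
  · rw [ruzsa, Finset.card_image_of_injOn, Nat.card_Icc, Nat.add_sub_cancel]
    intro u hu u' hu' h
    have := congrArg (ZMod.castHom hv' (ZMod (p - 1))) h
    erw [castHom_sub_one_ruzsaElement, castHom_sub_one_ruzsaElement] at this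
    exact eq_of_natCast_eq_of_le (Finset.mem_Icc.1 hu) (Finset.mem_Icc.1 hu') this
  · simp only [mem_ruzsa]
    rintro _ ⟨a, ha, rfl⟩ _ ⟨b, hb, rfl⟩ _ ⟨a', ha', rfl⟩ _ ⟨b', hb', rfl⟩ hab hab' h
    have h1 := congrArg (ZMod.castHom hv' (ZMod (p - 1))) h
    have h2 := congrArg (ZMod.castHom hv (ZMod p)) h
    simp only [map_sub, castHom_sub_one_ruzsaElement] at h1
    simp only [map_sub, castHom_ruzsaElement] at h2
    have hne : (g : ZMod p) ^ a ≠ (g : ZMod p) ^ b := fun e => hab (by rw [inj ha hb e])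
    -- Modulo `p - 1` the difference fixes the ratio of `g ^ a` and `g ^ b`; modulo `p` it fixes
    -- their difference. As the ratio is not `1`, both powers are determined.
    have h3 : (g : ZMod p) ^ (a' + b) = (g : ZMod p) ^ (a + b') := by
      rw [pow_eq_pow_iff_natCast_eq hg]
      push_cast
      linear_combination -h1
    rw [pow_add, pow_add] at h3
    have hbb : b = b' := by
      apply inj hb hb'
      apply mul_right_cancel₀ (sub_ne_zero.2 hne)
      linear_combination -(g : ZMod p) ^ b * h2 + h3
    subst hbb
    have haa : a = a' := by
      apply inj ha ha'
      linear_combination -h2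
    exact ⟨by rw [haa], rfl⟩

theorem card_filter_ruzsa_sub_one (hv : p - 1 ∣ v) (w : ZMod (p - 1)) :
    ((ruzsa p g v).filter fun s => ZMod.castHom hv (ZMod (p - 1)) s = w).card = 1 := by
  have : NeZero (p - 1) := ⟨(Nat.sub_pos_of_lt hp.out.one_lt).ne'⟩
  obtain ⟨u, hu, rfl⟩ := exists_natCast_eq_of_le w
  rw [Finset.card_eq_one]
  refine ⟨ruzsaElement p g v u, ?_⟩
  ext x
  simp only [Finset.mem_filter, mem_ruzsa, Finset.mem_singleton]
  constructor
  · rintro ⟨⟨u', hu', rfl⟩, h⟩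
    rw [castHom_sub_one_ruzsaElement] at h
    rw [eq_of_natCast_eq_of_le hu' hu h]
  · rintro rfl
    exact ⟨⟨u, hu, rfl⟩, castHom_sub_one_ruzsaElement hv u⟩

/-- The values `-g ^ u` run once through the nonzero residues and never hit `0`, hence the zero
weight on the diagonal. -/
theorem card_filter_ruzsa (hg : orderOf (g : ZMod p) = p - 1) (hv : p ∣ v)
    (w : ZMod p) :
    ((ruzsa p g v).filter fun s => ZMod.castHom hv (ZMod p) s = w).card = if w = 0 then 0 else 1 := by
  split_ifs with hw
  · rw [Finset.card_eq_zero, Finset.filter_eq_empty_iff]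
    intro x hx
    obtain ⟨u, hu, rfl⟩ := mem_ruzsa.1 hx
    rw [castHom_ruzsaElement, hw, neg_eq_zero]
    exact pow_ne_zero _ (natCast_ne_zero_of_orderOf hg)
  · obtain ⟨u, hu, hw'⟩ := exists_pow_eq_of_ne_zero hg (neg_ne_zero.2 hw)
    rw [Finset.card_eq_one]
    refine ⟨ruzsaElement p g v u, ?_⟩
    ext x
    simp only [Finset.mem_filter, mem_ruzsa, Finset.mem_singleton]
    constructor
    · rintro ⟨⟨u', hu', rfl⟩, h⟩
      rw [castHom_ruzsaElement, neg_eq_iff_eq_neg, ← hw', pow_eq_pow_iff_natCast_eq hg] at h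
      rw [eq_of_natCast_eq_of_le hu' hu h]
    · rintro rfl
      exact ⟨⟨u, hu, rfl⟩, by rw [castHom_ruzsaElement, hw', neg_neg]⟩

end Ruzsa

theorem exists_primitive_root (hp : p.Prime) : ∃ g : ℕ, orderOf (g : ZMod p) = p - 1 := by
  have : Fact p.Prime := ⟨hp⟩
  obtain ⟨γ, hγ⟩ := IsCyclic.exists_generator (α := (ZMod p)ˣ)
  refine ⟨(γ : ZMod p).val, ?_⟩
  rw [ZMod.natCast_zmod_val, orderOf_units, orderOf_eq_card_of_forall_mem_zpowers hγ,
    Nat.card_eq_fintype_card, ZMod.card_units]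

/-- The assertions on Ruzsa's ruler. -/
theorem ruzsa_configurations {p g : ℕ} (hp : p.Prime) (hg : orderOf (g : ZMod p) = p - 1) :
    IsModularGolombRuler (p ^ 2 - p) (p - 1) (ruzsa p g (p ^ 2 - p)) ∧
    (IsConfigMatrix (arranged (p - 1) p fun i j => i - j ∈ ruzsa p g ((p - 1) * p))
        (p ^ 2 - p) (p - 1) ∧
      IsBDC (arranged (p - 1) p fun i j => i - j ∈ ruzsa p g ((p - 1) * p)) (fun _ => 1) ∧
      ∀ c θ δ : ℕ, 2 ≤ c → c ≤ p - 1 → θ ≤ c + 1 → δ < c →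
        YieldsConfig (arranged (p - 1) p fun i j => i - j ∈ ruzsa p g ((p - 1) * p))
          c θ (c - δ)) ∧
    (IsConfigMatrix (arranged p (p - 1) fun i j => i - j ∈ ruzsa p g (p * (p - 1)))
        (p ^ 2 - p) (p - 1) ∧
      IsBDC (arranged p (p - 1) fun i j => i - j ∈ ruzsa p g (p * (p - 1)))
        (fun u => if (u : ℕ) = 0 then 0 else 1) ∧
      ∀ c θ δ : ℕ, 2 ≤ c → c ≤ p → θ ≤ c + 1 → δ < c - 1 →
        YieldsConfig (arranged p (p - 1) fun i j => i - j ∈ ruzsa p g (p * (p - 1)))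
          c θ (c - 1 - δ)) := by
  have : Fact p.Prime := ⟨hp⟩
  have : NeZero (p - 1) := ⟨(Nat.sub_pos_of_lt hp.one_lt).ne'⟩
  have : NeZero p := ⟨hp.ne_zero⟩
  have e1 : p ^ 2 - p = (p - 1) * p := by rw [Nat.sub_mul, one_mul, sq]
  have e2 : p ^ 2 - p = p * (p - 1) := by rw [e1, mul_comm]
  have r1 := isModularGolombRuler_ruzsa hg (dvd_mul_left p (p - 1)) (dvd_mul_right (p - 1) p)
  have r2 := isModularGolombRuler_ruzsa hg (dvd_mul_right p (p - 1)) (dvd_mul_left (p - 1) p)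
  have b1 : IsBDC (arranged (p - 1) p fun i j => i - j ∈ ruzsa p g ((p - 1) * p)) (fun _ => 1) :=
    isBDC_arranged fun u => card_filter_ruzsa_sub_one _ _
  have b2 : IsBDC (arranged p (p - 1) fun i j => i - j ∈ ruzsa p g (p * (p - 1)))
      (fun u => if (u : ℕ) = 0 then 0 else 1) := by
    refine isBDC_arranged fun u => (card_filter_ruzsa hg _ _).trans ?_
    have : ((u : ℕ) : ZMod p) = 0 ↔ (u : ℕ) = 0 := by
      rw [ZMod.natCast_eq_zero_iff]
      exact ⟨fun h => Nat.eq_zero_of_dvd_of_lt h u.2, fun h => h ▸ dvd_zero p⟩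
    simp only [this]
  refine ⟨?_, ⟨?_, b1, fun c θ δ h2 hc hθ hδ => ?_⟩, ?_, b2, fun c θ δ h2 hc hθ hδ => ?_⟩
  · exact isModularGolombRuler_ruzsa hg (e2 ▸ dvd_mul_right p (p - 1))
      (e1 ▸ dvd_mul_right (p - 1) p)
  · rw [e1]; exact r1.isConfigMatrix_arranged
  · exact b1.yieldsConfig_of_pos r1.unique_line_arranged (by simp) hc hθ (by omega) (by omega)
      (by omega)
  · rw [e2]; exact r2.isConfigMatrix_arranged
  · exact b2.yieldsConfig_of_pos_of_ne r2.unique_line_arranged (by simp) hc hθ (by omega)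
      (by omega) (by omega)

/-! ### Logarithms and functionals in finite field extensions. -/

/-- Through a logarithm this translates a power condition `z ^ n = 1` into a congruence modulo `m`.
-/
theorem ZMod.nsmul_eq_zero_iff_castHom {m n : ℕ} [NeZero m] [NeZero n] (i : ZMod (m * n)) :
    n • i = 0 ↔ ZMod.castHom (dvd_mul_right m n) (ZMod m) i = 0 := by
  obtain ⟨k, rfl⟩ := ZMod.natCast_zmod_surjective i
  rw [map_natCast, nsmul_eq_mul, ← Nat.cast_mul, ZMod.natCast_eq_zero_iff,
    ZMod.natCast_eq_zero_iff, mul_comm n k]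
  exact Nat.mul_dvd_mul_iff_right (Nat.pos_of_neZero n)

theorem exists_mulEquiv_zmod {K : Type*} [Field K] [Finite K] {n : ℕ} (h : Nat.card Kˣ = n) :
    Nonempty (Kˣ ≃* Multiplicative (ZMod n)) := by
  obtain ⟨γ, hγ⟩ := IsCyclic.exists_generator (α := Kˣ)
  exact ⟨(zmodMulEquivOfGenerator hγ h).symm⟩

section Singer

variable {F K : Type*} [Field F] [Field K] [Algebra F K] [Finite K]

/-- The Galois group is generated by the Frobenius map `x ↦ x ^ Nat.card F`, so being fixed by it is
being fixed by the whole group. -/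
theorem FiniteField.mem_range_algebraMap_iff_pow_natCard {x : K} :
    x ∈ Set.range (algebraMap F K) ↔ x ^ Nat.card F = x := by
  have : Finite F := Finite.of_injective _ (algebraMap F K).injective
  have := Fintype.ofFinite F
  rw [Nat.card_eq_fintype_card]
  constructor
  · rintro ⟨a, rfl⟩
    rw [← map_pow, FiniteField.pow_card]
  · intro h
    rw [IsGalois.mem_range_algebraMap_iff_fixed]
    intro σ
    obtain ⟨⟨m, hm⟩, rfl⟩ := (FiniteField.bijective_frobeniusAlgEquivOfAlgebraic_pow F K).2 σ
    change (FiniteField.frobeniusAlgEquivOfAlgebraic F K ^ m) x = x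
    clear hm
    induction m with
    | zero => rfl
    | succ m ih =>
      rw [pow_succ, AlgEquiv.mul_apply]
      simpa [h] using ih

theorem FiniteField.units_mem_range_algebraMap_iff {z : Kˣ} :
    (z : K) ∈ Set.range (algebraMap F K) ↔ z ^ (Nat.card F - 1) = 1 := by
  have : Finite F := Finite.of_injective _ (algebraMap F K).injective
  rw [FiniteField.mem_range_algebraMap_iff_pow_natCard, ← Units.val_pow_eq_pow_val, Units.val_inj]
  conv_lhs => rw [← Nat.sub_add_cancel (Nat.card_pos (α := F)), pow_succ, mul_eq_right]

/-- The discrete logarithm reduced modulo the index of the subgroup `Fˣ`. -/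
theorem castHom_log_eq_zero_iff {m : ℕ} [NeZero m]
    (lg : Kˣ ≃* Multiplicative (ZMod (m * (Nat.card F - 1)))) (z : Kˣ) :
    ZMod.castHom (dvd_mul_right m _) (ZMod m) (lg z).toAdd = 0 ↔
      (z : K) ∈ Set.range (algebraMap F K) := by
  have : Finite F := Finite.of_injective _ (algebraMap F K).injective
  have : NeZero (Nat.card F - 1) := ⟨(Nat.sub_pos_of_lt (Finite.one_lt_card (α := F))).ne'⟩
  rw [← ZMod.nsmul_eq_zero_iff_castHom, FiniteField.units_mem_range_algebraMap_iff,
    ← map_eq_one_iff lg lg.injective, map_pow]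
  rfl

/-- The linear functionals on `K` are the maps `x ↦ φ (m * x)`. -/
theorem exists_dualEquiv {φ : Module.Dual F K} (hφ : φ ≠ 0) :
    ∃ Φ : K ≃ₗ[F] Module.Dual F K, ∀ m x, Φ m x = φ (m * x) := by
  have : Finite F := Finite.of_injective _ (algebraMap F K).injective
  have : Module.Finite F K := .of_finite
  -- If `m ≠ 0`, then `m * x` runs through all of `K`, so `m` cannot give the zero functional; equal
  -- dimensions do the rest.
  have hinj : Function.Injective ((LinearMap.mul F K).compr₂ φ) := by
    rw [← LinearMap.ker_eq_bot, LinearMap.ker_eq_bot']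
    intro m hm
    by_contra hne
    apply hφ
    ext x
    have := LinearMap.congr_fun hm (m⁻¹ * x)
    simpa [hne] using this
  exact ⟨LinearEquiv.ofInjectiveOfFinrankEq _ hinj Subspace.dual_finrank_eq.symm, fun m x => rfl⟩

end Singer

/-! ### The starred affine plane. -/

section StarredPlane

variable {F : Type*} [Field F]

/-- The lines off the origin are the sets `ψ p = 1` with a nonzero functional `ψ`. -/
theorem exists_starredLine_of_dual {ψ : Module.Dual F (F × F)} (hψ : ψ ≠ 0) :
    ∃ l : StarredLine F, ∀ p, p ∈ (l : AffineSubspace F (F × F)) ↔ ψ p = 1 := by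
  obtain ⟨p₀, hp₀⟩ := LinearMap.surjective hψ 1
  have hmem : ∀ p, p ∈ AffineSubspace.mk' p₀ (LinearMap.ker ψ) ↔ ψ p = 1 := by
    intro p
    rw [AffineSubspace.mem_mk', vsub_eq_sub, LinearMap.mem_ker, map_sub, hp₀, sub_eq_zero]
  refine ⟨⟨AffineSubspace.mk' p₀ (LinearMap.ker ψ), ?_, ?_⟩, hmem⟩
  · rw [AffineSubspace.direction_mk']
    have := Module.Dual.finrank_ker_add_one_of_ne_zero hψ
    rw [Module.finrank_prod, Module.finrank_self] at this
    omega
  · rw [hmem, map_zero]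
    exact zero_ne_one

/-- The direction is the kernel of some functional, which is constant on the line. The constant is
nonzero as the line avoids the origin, so it can be scaled to `1`. -/
theorem exists_dual_of_starredLine (l : StarredLine F) :
    ∃ ψ : Module.Dual F (F × F), ψ ≠ 0 ∧
      ∀ p, p ∈ (l : AffineSubspace F (F × F)) ↔ ψ p = 1 := by
  obtain ⟨l, hl, h0⟩ := l
  have hne : (l : Set (F × F)).Nonempty := by
    rw [Set.nonempty_iff_ne_empty]
    intro h
    rw [AffineSubspace.coe_eq_bot_iff] at h
    rw [h, AffineSubspace.direction_bot, finrank_bot] at hl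
    exact zero_ne_one hl
  obtain ⟨p₀, hp₀⟩ := hne
  have hlt : l.direction < ⊤ := by
    refine lt_top_iff_ne_top.2 fun h => ?_
    rw [h, finrank_top, Module.finrank_prod, Module.finrank_self] at hl
    omega
  obtain ⟨ψ, hψ, hle⟩ := Submodule.exists_le_ker_of_lt_top _ hlt
  have hker : l.direction = LinearMap.ker ψ := by
    apply Submodule.eq_of_le_of_finrank_eq hle
    have := Module.Dual.finrank_ker_add_one_of_ne_zero hψ
    rw [Module.finrank_prod, Module.finrank_self] at this
    omega
  have hmem : ∀ p, p ∈ l ↔ ψ p = ψ p₀ := by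
    intro p
    rw [← AffineSubspace.vsub_right_mem_direction_iff_mem hp₀, hker, vsub_eq_sub,
      LinearMap.mem_ker, map_sub, sub_eq_zero]
  have hne : ψ p₀ ≠ 0 := fun h => h0 ((hmem 0).2 (by rw [h, map_zero]))
  refine ⟨(ψ p₀)⁻¹ • ψ, smul_ne_zero (inv_ne_zero hne) hψ, fun p => ?_⟩
  rw [hmem, LinearMap.smul_apply, smul_eq_mul, inv_mul_eq_one₀ hne, eq_comm]

/-- Rescaling a vector with `ψ x ≠ 0` to value `1` shows that `ψ'` takes the same value there; by
symmetry the zeros agree too. -/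
theorem Module.Dual.eq_of_forall_eq_one_iff {V : Type*} [AddCommGroup V] [Module F V]
    {ψ ψ' : Module.Dual F V} (h : ∀ x, ψ x = 1 ↔ ψ' x = 1) : ψ = ψ' := by
  have key : ∀ {ψ ψ' : Module.Dual F V}, (∀ x, ψ x = 1 ↔ ψ' x = 1) → ∀ x, ψ x ≠ 0 →
      ψ' x = ψ x := by
    intro ψ ψ' h x hx
    have h1 : ψ ((ψ x)⁻¹ • x) = 1 := by simp [hx]
    rw [h, map_smul, smul_eq_mul, inv_mul_eq_one₀ hx] at h1
    exact h1.symm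
  ext x
  by_cases hx : ψ x = 0
  · by_contra hne
    exact hne (key (fun x => (h x).symm) x fun h' => hne (hx.trans h'.symm))
  · exact (key h x hx).symm

/-- A cyclic numbering of the starred affine plane and the corresponding ruler. -/
theorem exists_cyclicNumbering_starredPlane (F : Type*) [Field F] [Finite F] {q : ℕ}
    (hq : Nat.card F = q) :
    ∃ (S : Finset (ZMod ((q + 1) * (q - 1))))
      (e : ZMod ((q + 1) * (q - 1)) ≃ StarredPoint F)
      (f : ZMod ((q + 1) * (q - 1)) ≃ StarredLine F),
      (∀ i j, starredInc F (e i) (f j) ↔ i - j ∈ S) ∧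
      IsModularGolombRuler ((q + 1) * (q - 1)) q S ∧
      ∀ u, (S.filter fun s => ZMod.castHom (dvd_mul_right (q + 1) (q - 1)) (ZMod (q + 1)) s = u).card
        = if u = 0 then 0 else 1 := by
  classical
  have hq1 : 1 < q := hq ▸ Finite.one_lt_card
  have : NeZero (q - 1) := ⟨(Nat.sub_pos_of_lt hq1).ne'⟩
  obtain ⟨p, hp⟩ := CharP.exists F
  have : Fact p.Prime := ⟨CharP.char_is_prime F p⟩
  let K := FiniteField.Extension F p 2
  have hK : Module.finrank F K = 2 := FiniteField.finrank_extension F p 2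
  have hcard : Nat.card Kˣ = (q + 1) * (q - 1) := by
    rw [Nat.card_units, FiniteField.natCard_extension, hq, ← Nat.sq_sub_sq, one_pow]
  obtain ⟨lg⟩ := exists_mulEquiv_zmod hcard
  -- the element with logarithm `i`
  let x : ZMod ((q + 1) * (q - 1)) → Kˣ := fun i => lg.symm (Multiplicative.ofAdd i)
  have x_inj : Function.Injective x := lg.symm.injective.comp Multiplicative.ofAdd.injective
  have x_surj : Function.Surjective x := lg.symm.surjective.comp Multiplicative.ofAdd.surjective
  have x_sub : ∀ i j, x (i - j) = (x j)⁻¹ * x i := fun i j => by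
    simp only [x]
    rw [ofAdd_sub, map_div, div_eq_inv_mul]
  have x_add : ∀ i j, x (i + j) = x i * x j := fun i j => by
    simp only [x]
    rw [ofAdd_add, map_mul]
  have x_cast : ∀ i, ZMod.castHom (dvd_mul_right (q + 1) (q - 1)) (ZMod (q + 1)) i = 0 ↔
      (x i : K) ∈ Set.range (algebraMap F K) := fun i => by
    subst hq
    rw [← castHom_log_eq_zero_iff lg]
    simp [x]
  -- a functional with kernel `F`
  obtain ⟨φ, hφ, hle⟩ := Submodule.exists_le_ker_of_lt_top (Submodule.span F {(1 : K)}) (by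
    refine lt_top_iff_ne_top.2 fun h => ?_
    have := finrank_span_singleton (K := F) (one_ne_zero (α := K))
    rw [h, finrank_top, hK] at this
    omega)
  have hker : Submodule.span F {(1 : K)} = LinearMap.ker φ := by
    apply Submodule.eq_of_le_of_finrank_eq hle
    have := Module.Dual.finrank_ker_add_one_of_ne_zero hφ
    rw [finrank_span_singleton one_ne_zero]
    omega
  have hφ0 : ∀ z : K, φ z = 0 ↔ z ∈ Set.range (algebraMap F K) := fun z => by
    rw [← LinearMap.mem_ker, ← hker, Submodule.mem_span_singleton]
    simp only [Set.mem_range, Algebra.algebraMap_eq_smul_one]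
  have hφmul : ∀ (a : F) (z : K), φ (algebraMap F K a * z) = a * φ z := fun a z => by
    rw [← Algebra.smul_def, map_smul, smul_eq_mul]
  obtain ⟨Φ, hΦ⟩ := exists_dualEquiv hφ
  let S : Finset (ZMod ((q + 1) * (q - 1))) := Finset.univ.filter fun i => φ (x i) = 1
  have mem_S : ∀ i, i ∈ S ↔ φ (x i) = 1 := fun i => by simp [S]
  -- the weights
  have hw : ∀ u, (S.filter fun s =>
      ZMod.castHom (dvd_mul_right (q + 1) (q - 1)) (ZMod (q + 1)) s = u).card =
        if u = 0 then 0 else 1 := by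
    intro u
    split_ifs with hu
    · rw [Finset.card_eq_zero, Finset.filter_eq_empty_iff]
      intro s hs hsu
      rw [mem_S] at hs
      rw [hu, x_cast, ← hφ0, hs] at hsu
      exact one_ne_zero hsu
    · obtain ⟨i, rfl⟩ := ZMod.castHom_surjective (dvd_mul_right (q + 1) (q - 1)) u
      rw [x_cast, ← hφ0] at hu
      -- Multiplying by the scalar `(φ (x i))⁻¹` of `F` stays in the class modulo `q + 1` and
      -- normalises the value to `1`.
      obtain ⟨k, hk⟩ := x_surj (Units.map (algebraMap F K).toMonoidHom (Units.mk0 _ hu)⁻¹)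
      have hk' : (x k : K) = algebraMap F K (φ (x i))⁻¹ := by rw [hk]; simp
      have hk0 := (x_cast k).2 ⟨_, hk'.symm⟩
      have hki : φ (x (k + i)) = 1 := by
        rw [x_add, Units.val_mul, hk', hφmul, inv_mul_cancel₀ hu]
      rw [Finset.card_eq_one]
      refine ⟨k + i, ?_⟩
      ext s
      simp only [Finset.mem_filter, mem_S, Finset.mem_singleton]
      constructor
      · rintro ⟨h1, h2⟩
        -- Another element of the class differs by a factor `b` in `F`, and `φ` scales by `b`; value
        -- `1` forces `b = 1`.
        have h3 : ZMod.castHom (dvd_mul_right (q + 1) (q - 1)) (ZMod (q + 1)) (s - (k + i)) = 0 := by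
          rw [map_sub, h2, map_add, hk0, zero_add, sub_self]
        obtain ⟨b, hb⟩ := (x_cast _).1 h3
        have h4 : x s = x (s - (k + i)) * x (k + i) := by rw [← x_add, sub_add_cancel]
        rw [h4, Units.val_mul, ← hb, hφmul, hki, mul_one] at h1
        rw [h1, map_one] at hb
        apply x_inj
        rw [h4, show x (s - (k + i)) = 1 from Units.ext hb.symm, one_mul]
      · rintro rfl
        exact ⟨hki, by rw [map_add, hk0, zero_add]⟩
  -- the points and the lines
  obtain ⟨L⟩ : Nonempty (K ≃ₗ[F] F × F) := by
    have : Module.Finite F K := .of_finite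
    exact FiniteDimensional.nonempty_linearEquiv_of_finrank_eq
      (by rw [hK, Module.finrank_prod, Module.finrank_self])
  let e : ZMod ((q + 1) * (q - 1)) → StarredPoint F := fun i =>
    ⟨L (x i), by simp⟩
  have he : Function.Bijective e := by
    constructor
    · intro i j h
      exact x_inj (Units.ext (L.injective (congrArg Subtype.val h)))
    · rintro ⟨p, hp⟩
      obtain ⟨i, hi⟩ := x_surj (Units.mk0 (L.symm p) (by simpa using hp))
      exact ⟨i, Subtype.ext (by simp [e, hi])⟩
  -- The inverse of `x j` makes the incidence condition `φ (x (i - j)) = 1`.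
  have hf : ∀ j, ∃ l : StarredLine F, ∀ p, p ∈ (l : AffineSubspace F (F × F)) ↔
      Φ ((x j)⁻¹ : Kˣ) (L.symm p) = 1 := fun j =>
    exists_starredLine_of_dual (ψ := (Φ ((x j)⁻¹ : Kˣ)).comp L.symm.toLinearMap) fun h => by
      have h' : Φ ((x j)⁻¹ : Kˣ) = 0 := by
        ext z
        simpa using LinearMap.congr_fun h (L z)
      simp at h'
  choose f hf using hf
  have hfb : Function.Bijective f := by
    constructor
    · intro i j h
      have : Φ ((x i)⁻¹ : Kˣ) = Φ ((x j)⁻¹ : Kˣ) := by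
        refine Module.Dual.eq_of_forall_eq_one_iff fun z => ?_
        have := (hf i (L z)).symm.trans (h ▸ hf j (L z))
        simpa using this
      exact x_inj (inv_injective (Units.ext (Φ.injective this)))
    · intro l
      obtain ⟨ψ, hψ, hl⟩ := exists_dual_of_starredLine l
      obtain ⟨m, hm⟩ := Φ.surjective (ψ.comp L.toLinearMap)
      have hm0 : m ≠ 0 := by
        rintro rfl
        apply hψ
        ext1 <;> ext1
        all_goals
          simpa using (LinearMap.congr_fun hm (L.symm _)).symm
      obtain ⟨j, hj⟩ := x_surj (Units.mk0 m hm0)⁻¹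
      refine ⟨j, Subtype.ext (AffineSubspace.ext fun p => ?_)⟩
      rw [hf, hl, hj, inv_inv, Units.val_mk0, hm]
      simp
  refine ⟨S, Equiv.ofBijective e he, Equiv.ofBijective f hfb, fun i j => ?_, ⟨?_, ?_⟩, hw⟩
  · rw [mem_S, x_sub, Units.val_mul, ← hΦ]
    simp only [starredInc, Equiv.ofBijective_apply, hf, e, LinearEquiv.symm_apply_apply]
  · rw [Finset.card_eq_sum_card_fiberwise (f := ZMod.castHom (dvd_mul_right (q + 1) (q - 1))
      (ZMod (q + 1))) (t := Finset.univ) (by simp), Finset.sum_congr rfl fun u _ => hw u]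
    simp [Finset.sum_ite, Finset.filter_ne', Finset.card_erase_of_mem, ZMod.card]
  · intro a ha b hb a' ha' b' hb' hab _ h
    rw [mem_S] at ha hb ha' hb'
    have hm : x (b - a) = x (b' - a') := by rw [← neg_sub a b, h, neg_sub]
    have e1 : (x b : K) = x (b - a) * x a := by rw [← Units.val_mul, ← x_add, sub_add_cancel]
    have e2 : (x b' : K) = x (b - a) * x a' := by
      rw [hm, ← Units.val_mul, ← x_add, sub_add_cancel]
    -- If `a ≠ a'`, then `x a - x a'` and its product with the ratio `x (b - a)` both lie in the
    -- kernel `F` of `φ`. The ratio is then in `F`, and `φ (x a) = φ (x b) = 1` makes it `1`,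
    -- contrary to `a ≠ b`.
    have haa : a = a' := by
      by_contra hne
      have hz : φ (x a - x a') = 0 := by rw [map_sub, ha, ha', sub_self]
      have hz' : φ (x (b - a) * (x a - x a')) = 0 := by
        rw [mul_sub, ← e1, ← e2, map_sub, hb, hb', sub_self]
      have hz0 : (x a - x a' : K) ≠ 0 := sub_ne_zero.2 fun h => hne (x_inj (Units.ext h))
      rw [hφ0] at hz hz'
      obtain ⟨c, hc⟩ := hz
      obtain ⟨c', hc'⟩ := hz'
      have hm' : (x (b - a) : K) = algebraMap F K (c' / c) := by
        rw [map_div₀, hc, hc', mul_div_cancel_right₀ _ hz0]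
      rw [e1, hm', hφmul, ha, mul_one] at hb
      rw [hb, map_one] at hm'
      rw [hm', one_mul] at e1
      exact hab (x_inj (Units.ext e1.symm))
    refine ⟨haa, ?_⟩
    rw [haa] at h
    exact sub_right_injective h

end StarredPlane

/-- The assertions on the starred affine plane. -/
theorem starredPlane_configurations {q : ℕ} (F : Type*) [Field F] [Fintype F]
    [Fintype (StarredPoint F)] [Fintype (StarredLine F)] (hq : Fintype.card F = q) :
    IsSymmConfig (starredInc F) (q ^ 2 - 1) q ∧
    ∃ (e : ZMod ((q + 1) * (q - 1)) ≃ StarredPoint F)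
      (f : ZMod ((q + 1) * (q - 1)) ≃ StarredLine F),
      IsCyclicNumbering (starredInc F) e f ∧
      IsBDC (arranged (q + 1) (q - 1) fun i j => starredInc F (e i) (f j))
        (fun u => if (u : ℕ) = 0 then 0 else 1) ∧
      ∀ c θ δ : ℕ, 2 ≤ c → c ≤ q + 1 → θ ≤ c + 1 → δ < c - 1 →
        YieldsConfig (arranged (q + 1) (q - 1) fun i j => starredInc F (e i) (f j))
          c θ (c - 1 - δ) := by
  have hq1 : 1 < q := hq ▸ Fintype.one_lt_card
  have : NeZero (q - 1) := ⟨(Nat.sub_pos_of_lt hq1).ne'⟩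
  obtain ⟨S, e, f, hI, hS, hw⟩ := exists_cyclicNumbering_starredPlane F
    (Nat.card_eq_fintype_card.trans hq)
  have hb : IsBDC (arranged (q + 1) (q - 1) fun i j => i - j ∈ S)
      (fun u => if (u : ℕ) = 0 then 0 else 1) := by
    refine isBDC_arranged fun u => (hw _).trans ?_
    have : ((u : ℕ) : ZMod (q + 1)) = 0 ↔ (u : ℕ) = 0 := by
      rw [ZMod.natCast_eq_zero_iff]
      exact ⟨fun h => Nat.eq_zero_of_dvd_of_lt h u.2, fun h => h ▸ dvd_zero _⟩
    simp only [this]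
  refine ⟨?_, e, f, fun i j => ?_, ?_⟩
  · have := hS.isSymmConfig e f hI
    rwa [← Nat.sq_sub_sq, one_pow] at this
  · rw [hI, hI, add_sub_add_right_eq_sub]
  · simp only [hI]
    exact ⟨hb, fun c θ δ h2 hc hθ hδ => hb.yieldsConfig_of_pos_of_ne hS.unique_line_arranged
      (fun u hu => by simp only [if_neg hu]; exact one_ne_zero) hc hθ (by omega) (by omega)
      (by omega)⟩

/-! ### Logarithms modulo `Fˣ` and the points of a projective space. -/

section Log

variable {F K : Type*} [Field F] [Field K] [Algebra F K] [Finite K]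

/-- The group `Kˣ / Fˣ` is cyclic. -/
theorem exists_log {v : ℕ} [NeZero v] (h : Nat.card Kˣ = v * (Nat.card F - 1)) :
    ∃ lg : Kˣ →* Multiplicative (ZMod v), Function.Surjective lg ∧
      ∀ z, lg z = 1 ↔ (z : K) ∈ Set.range (algebraMap F K) := by
  obtain ⟨Lg⟩ := exists_mulEquiv_zmod h
  refine ⟨(AddMonoidHom.toMultiplicative (ZMod.castHom (dvd_mul_right v (Nat.card F - 1))
    (ZMod v)).toAddMonoidHom).comp Lg.toMonoidHom, fun u => ?_, fun z => ?_⟩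
  · obtain ⟨i, hi⟩ := ZMod.castHom_surjective (dvd_mul_right v (Nat.card F - 1)) u.toAdd
    obtain ⟨z, hz⟩ := Lg.surjective (Multiplicative.ofAdd i)
    refine ⟨z, ?_⟩
    simp only [MonoidHom.comp_apply, MulEquiv.toMonoidHom_eq_coe, MonoidHom.coe_coe, hz]
    exact congrArg Multiplicative.ofAdd hi
  · rw [← castHom_log_eq_zero_iff Lg]
    rfl

variable {v : ℕ} {lg : Kˣ →* Multiplicative (ZMod v)} {V : Type*} [AddCommGroup V] [Module F V]

omit [Finite K] in
theorem mk_units_eq_iff (hlg : ∀ z, lg z = 1 ↔ (z : K) ∈ Set.range (algebraMap F K))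
    (L : K ≃ₗ[F] V) (z w : Kˣ) (hz : L z ≠ 0) (hw : L w ≠ 0) :
    Projectivization.mk F (L z) hz = Projectivization.mk F (L w) hw ↔ lg z = lg w := by
  rw [Projectivization.mk_eq_mk_iff', ← div_eq_one, ← map_div, hlg]
  refine exists_congr fun a => ?_
  rw [← map_smul, L.injective.eq_iff, Algebra.smul_def, Units.val_div_eq_div_val,
    eq_div_iff w.ne_zero]

omit [Finite K] in
/-- The points of the projective space of a field extension are numbered by the logarithm. -/
theorem exists_numbering (hs : Function.Surjective lg)
    (hlg : ∀ z, lg z = 1 ↔ (z : K) ∈ Set.range (algebraMap F K)) (L : K ≃ₗ[F] V) :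
    ∃ e : ZMod v ≃ ℙ F V, ∀ (z : Kˣ) (hz : L z ≠ 0),
      e (lg z).toAdd = Projectivization.mk F (L z) hz := by
  have hne : ∀ z : Kˣ, L z ≠ 0 := fun z => by simp
  choose x hx using fun i : ZMod v => hs (Multiplicative.ofAdd i)
  have hb : Function.Bijective fun i => Projectivization.mk F (L (x i)) (hne _) := by
    constructor
    · intro i j h
      simp only [mk_units_eq_iff hlg, hx] at h
      exact Multiplicative.ofAdd.injective h
    · intro p
      induction p with | h w hw => ?_
      have hw' : L.symm w ≠ 0 := by simpa using hw
      refine ⟨(lg (Units.mk0 _ hw')).toAdd, ?_⟩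
      have := (mk_units_eq_iff hlg L (x (lg (Units.mk0 _ hw')).toAdd) (Units.mk0 _ hw')
        (hne _) (hne _)).2 (hx _)
      simpa using this
  exact ⟨Equiv.ofBijective _ hb, fun z hz => (mk_units_eq_iff hlg L _ _ _ _).2 (hx _)⟩

/-- Two vectors of a three-dimensional space lie in the kernel of a functional. -/
theorem exists_dual_eq_zero_pair {V : Type*} [AddCommGroup V] [Module F V]
    (hV : Module.finrank F V = 3) (z z' : V) :
    ∃ ψ : Module.Dual F V, ψ ≠ 0 ∧ ψ z = 0 ∧ ψ z' = 0 := by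
  classical
  obtain ⟨ψ, hψ, hle⟩ := Submodule.exists_le_ker_of_lt_top (Submodule.span F {z, z'}) (by
    refine lt_top_iff_ne_top.2 fun h => ?_
    have h1 := finrank_span_finset_le_card (R := F) ({z, z'} : Finset V)
    rw [Finset.coe_pair, Set.finrank, h, finrank_top, hV] at h1
    have := Finset.card_le_two (a := z) (b := z')
    omega)
  exact ⟨ψ, hψ, hle (Submodule.subset_span (by simp)), hle (Submodule.subset_span (by simp))⟩

end Log

/-! ### Subfields of orders `s` and `s ^ 3`. -/

section FixedSubfield

/-- The elements fixed by a power of the Frobenius map. -/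
def frobeniusFixed (K : Type*) [Field K] (p k : ℕ) [ExpChar K p] : Subfield K :=
  (iterateFrobenius K p k).eqLocusField (RingHom.id K)

theorem mem_frobeniusFixed {K : Type*} [Field K] {p k : ℕ} [ExpChar K p] {x : K} :
    x ∈ frobeniusFixed K p k ↔ x ^ p ^ k = x := by
  rw [frobeniusFixed, RingHom.mem_eqLocusField, iterateFrobenius_def, RingHom.id_apply]

/-- The nonzero fixed elements are the kernel of the power map with exponent `p ^ k - 1` on the
cyclic group `Kˣ`; the divisibility makes its order exactly `p ^ k - 1`. -/
theorem natCard_frobeniusFixed {K : Type*} [Field K] [Finite K] {p k : ℕ} [ExpChar K p]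
    (h : p ^ k - 1 ∣ Nat.card K - 1) : Nat.card (frobeniusFixed K p k) = p ^ k := by
  have hp : 0 < p ^ k := Nat.pow_pos (expChar_pos K p)
  have hker : Nat.card (powMonoidHom (p ^ k - 1) : Kˣ →* Kˣ).ker = p ^ k - 1 := by
    rw [IsCyclic.card_powMonoidHom_ker, Nat.card_units, Nat.gcd_eq_right h]
  have hrange : Set.range (Units.map (frobeniusFixed K p k).subtype.toMonoidHom) =
      ((powMonoidHom (p ^ k - 1) : Kˣ →* Kˣ).ker : Set Kˣ) := by
    ext z
    have hz : z ∈ (powMonoidHom (p ^ k - 1) : Kˣ →* Kˣ).ker ↔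
        (z : K) ∈ frobeniusFixed K p k := by
      rw [MonoidHom.mem_ker, powMonoidHom_apply, mem_frobeniusFixed, ← Units.val_pow_eq_pow_val,
        Units.val_inj]
      conv_rhs => rw [← Nat.sub_add_cancel hp, pow_succ, mul_eq_right]
    rw [SetLike.mem_coe, hz]
    constructor
    · rintro ⟨w, rfl⟩
      exact (w : frobeniusFixed K p k).2
    · intro hz
      exact ⟨Units.mk0 ⟨z, hz⟩ fun h => z.ne_zero (congrArg Subtype.val h), Units.ext rfl⟩
  have h1 : Nat.card (frobeniusFixed K p k)ˣ = p ^ k - 1 := by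
    rw [← hker, ← Nat.card_range_of_injective
      (Units.map_injective (f := (frobeniusFixed K p k).subtype.toMonoidHom)
        (frobeniusFixed K p k).subtype_injective), hrange]
    rfl
  rw [Nat.card_units] at h1
  have := Nat.card_pos (α := frobeniusFixed K p k)
  omega

end FixedSubfield

/-- Finite fields of orders `s` and `s ^ 3` inside the extension `K` of degree three of the field
`F` of order `s ^ 2`. -/
structure BaerTower (F : Type*) {K : Type*} [Field F] [Field K] [Algebra F K] (s : ℕ)
    (F₀ K₀ : Subfield K) : Prop where
  one_lt : 1 < s
  mem_base : ∀ x, x ∈ F₀ ↔ x ^ s = x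
  mem_cubic : ∀ x, x ∈ K₀ ↔ x ^ s ^ 3 = x
  card_base : Nat.card F₀ = s
  card_cubic : Nat.card K₀ = s ^ 3
  card_field : Nat.card F = s ^ 2
  card_top : Nat.card K = s ^ 6
  finrank_top : Module.finrank F K = 3

theorem exists_baerTower {F K : Type*} [Field F] [Field K] [Algebra F K] [Finite K] {s : ℕ}
    (hF : Nat.card F = s ^ 2) (hK : Module.finrank F K = 3) :
    ∃ F₀ K₀ : Subfield K, BaerTower F s F₀ K₀ := by
  have : Finite F := Finite.of_injective _ (algebraMap F K).injective
  have := Fintype.ofFinite F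
  obtain ⟨p, _, m, hp, hm⟩ := FiniteField.card' F
  have : Fact p.Prime := ⟨hp⟩
  have : CharP K p := charP_of_injective_algebraMap (algebraMap F K).injective p
  rw [← Nat.card_eq_fintype_card, hF] at hm
  obtain ⟨n, -, rfl⟩ := (Nat.dvd_prime_pow hp).1 (hm ▸ dvd_pow_self s two_ne_zero)
  have hKc : Nat.card K = (p ^ n) ^ 6 := by
    rw [Module.natCard_eq_pow_finrank (K := F), hF, hK, ← pow_mul]
  have h3 : p ^ (n * 3) = (p ^ n) ^ 3 := pow_mul p n 3
  have hs : 1 < p ^ n := by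
    have : 1 < (p ^ n) ^ 2 := hF ▸ Finite.one_lt_card
    by_contra hle
    have := Nat.pow_le_one_iff (n := 2) two_ne_zero |>.2 (not_lt.1 hle)
    omega
  refine ⟨frobeniusFixed K p n, frobeniusFixed K p (n * 3), hs, fun x => mem_frobeniusFixed,
    fun x => by rw [mem_frobeniusFixed, h3], natCard_frobeniusFixed ?_, ?_, hF, hKc, hK⟩
  · rw [hKc]
    simpa using Nat.sub_dvd_pow_sub_pow (p ^ n) 1 6
  · rw [natCard_frobeniusFixed, h3]
    rw [hKc, h3]
    rw [show (p ^ n) ^ 6 = ((p ^ n) ^ 3) ^ 2 from pow_mul (p ^ n) 3 2]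
    simpa only [one_pow] using Nat.sub_dvd_pow_sub_pow ((p ^ n) ^ 3) 1 2

namespace BaerTower

variable {F K : Type*} [Field F] [Field K] [Algebra F K] [Finite K] {s : ℕ} {F₀ K₀ : Subfield K}

omit [Finite K] in
theorem pow_sq_eq (T : BaerTower F s F₀ K₀) {x : K} (hx : x ∈ F₀) : x ^ s ^ 2 = x := by
  have h := (T.mem_base x).1 hx
  rw [sq, pow_mul, h, h]

omit [Finite K] in
theorem base_le_cubic (T : BaerTower F s F₀ K₀) : F₀ ≤ K₀ := fun x hx => by
  have h := (T.mem_base x).1 hx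
  rw [T.mem_cubic, pow_succ, pow_mul, T.pow_sq_eq hx, h]

theorem mem_field_iff (T : BaerTower F s F₀ K₀) {x : K} :
    x ∈ Set.range (algebraMap F K) ↔ x ^ s ^ 2 = x := by
  rw [FiniteField.mem_range_algebraMap_iff_pow_natCard, T.card_field]

theorem mem_field_of_mem_base (T : BaerTower F s F₀ K₀) {x : K} (hx : x ∈ F₀) :
    x ∈ Set.range (algebraMap F K) := T.mem_field_iff.2 (T.pow_sq_eq hx)

/-- From `x ^ s ^ 2 = x` and `x ^ s ^ 3 = x` follows `x ^ s = x`. Hence `K₀ ∩ F` is `F₀`, which is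
what makes the subplanes have order `s`. -/
theorem mem_base_of_mem_field (T : BaerTower F s F₀ K₀) {x : K} (hx : x ∈ K₀)
    (hx' : x ∈ Set.range (algebraMap F K)) : x ∈ F₀ := by
  rw [T.mem_cubic] at hx
  rw [T.mem_field_iff] at hx'
  rw [T.mem_base]
  conv_lhs => rw [← hx']
  rw [← pow_mul, ← pow_succ, hx]

/-- `K` is generated by `K₀` as a vector space over `F`. -/
theorem exists_add_mul (T : BaerTower F s F₀ K₀) :
    ∃ θ : F, ∀ z : K, ∃ y ∈ K₀, ∃ y' ∈ K₀, z = y + θ • y' := by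
  have hs := T.one_lt
  have : ∃ θ : F, algebraMap F K θ ∉ F₀ := by
    by_contra! h
    have := Nat.card_le_card_of_injective (fun a => (⟨_, h a⟩ : F₀))
      fun a b hab => (algebraMap F K).injective (congrArg Subtype.val hab)
    rw [T.card_field, T.card_base] at this
    nlinarith
  obtain ⟨θ, hθ⟩ := this
  refine ⟨θ, ?_⟩
  -- A coincidence would express `θ` as a quotient of elements of `K₀`, putting it in `K₀ ∩ F = F₀`.
  -- Surjectivity then follows from `s ^ 3 * s ^ 3 = s ^ 6`.
  have hinj : Function.Injective fun y : K₀ × K₀ => (y.1 : K) + θ • (y.2 : K) := by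
    rintro ⟨y, y'⟩ ⟨w, w'⟩ h
    simp only [Algebra.smul_def] at h
    have h2 : y' = w' := by
      by_contra hne
      have hne' : ((y' : K) - w') ≠ 0 := sub_ne_zero.2 fun h => hne (Subtype.ext h)
      apply hθ
      apply T.mem_base_of_mem_field _ ⟨θ, rfl⟩
      have : algebraMap F K θ = (w - y) / (y' - w') := by
        rw [eq_div_iff hne']
        linear_combination h
      rw [this]
      exact div_mem (sub_mem w.2 y.2) (sub_mem y'.2 w'.2)
    subst h2
    rw [add_left_inj] at h
    rw [Subtype.ext h]
  have := (Function.Injective.bijective_of_nat_card_le hinj (by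
    rw [Nat.card_prod, T.card_cubic, T.card_top]
    exact le_of_eq (by ring))).2
  intro z
  obtain ⟨⟨y, y'⟩, h⟩ := this z
  exact ⟨y, y.2, y', y'.2, h.symm⟩

theorem eq_zero_of_forall_cubic (T : BaerTower F s F₀ K₀) {ψ : Module.Dual F K}
    (h : ∀ y ∈ K₀, ψ y = 0) : ψ = 0 := by
  obtain ⟨θ, hθ⟩ := T.exists_add_mul
  ext z
  obtain ⟨y, hy, y', hy', rfl⟩ := hθ z
  simp [h y hy, h y' hy']

/-- With `d = s ^ 2 + s + 1`, the left side says that the logarithm modulo `Fˣ` is `0` modulo `t`,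
so this identifies that class with `F * K₀`. Forwards, `z` is `z ^ d` times the inverse of `z ^ (s *
(s + 1))`, which lies in `K₀`. Backwards, `y ^ d` is the norm of `y` from `K₀` to `F₀`. -/
theorem exists_mul_cubic_iff (T : BaerTower F s F₀ K₀) (z : Kˣ) :
    ((z ^ (s ^ 2 + s + 1) : Kˣ) : K) ∈ Set.range (algebraMap F K) ↔
      ∃ a : F, ∃ y ∈ K₀, (z : K) = algebraMap F K a * y := by
  have hs := T.one_lt
  constructor
  · intro h
    have h1 := FiniteField.units_mem_range_algebraMap_iff.1 h
    rw [T.card_field, ← pow_mul] at h1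
    obtain ⟨a, ha⟩ := h
    refine ⟨a, ((z ^ (s * (s + 1)))⁻¹ : Kˣ), ?_, ?_⟩
    · rw [T.mem_cubic, ← Units.val_pow_eq_pow_val, Units.val_inj]
      apply mul_right_cancel (b := z ^ (s * (s + 1)))
      rw [inv_mul_cancel, inv_pow, inv_mul_eq_one, ← pow_mul]
      have e : s * (s + 1) * s ^ 3 = (s ^ 2 + s + 1) * (s ^ 2 - 1) * s + s * (s + 1) := by
        have : 1 ≤ s ^ 2 := Nat.one_le_pow _ _ (by omega)
        zify [this]
        ring
      rw [e, pow_add, pow_mul, h1, one_pow, one_mul]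
    · rw [ha, ← Units.val_mul, ← div_eq_mul_inv]
      congr 1
      rw [eq_div_iff_mul_eq', ← pow_succ']
      ring_nf
  · rintro ⟨a, y, hy, hz⟩
    rw [Units.val_pow_eq_pow_val, hz, mul_pow]
    obtain ⟨b, hb⟩ : y ^ (s ^ 2 + s + 1) ∈ Set.range (algebraMap F K) := by
      apply T.mem_field_of_mem_base
      rw [T.mem_base, ← pow_mul]
      have : (s ^ 2 + s + 1) * s = s ^ 3 + (s ^ 2 + s) := by ring
      rw [this, pow_add, (T.mem_cubic y).1 hy, ← pow_succ']
    exact ⟨a ^ (s ^ 2 + s + 1) * b, by rw [map_mul, map_pow, hb]⟩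

/-- The elements of `K₀` in the kernel of a functional. -/
def kernelPart (T : BaerTower F s F₀ K₀) (ψ : Module.Dual F K) : Submodule F₀ K where
  carrier := {y | y ∈ K₀ ∧ ψ y = 0}
  add_mem' := fun ha hb => ⟨add_mem ha.1 hb.1, by rw [map_add, ha.2, hb.2, add_zero]⟩
  zero_mem' := ⟨zero_mem _, map_zero _⟩
  smul_mem' := fun a y hy => by
    refine ⟨mul_mem (T.base_le_cubic a.2) hy.1, ?_⟩
    obtain ⟨b, hb⟩ := T.mem_field_of_mem_base a.2
    rw [Subfield.smul_def, smul_eq_mul, ← hb, ← Algebra.smul_def, map_smul, hy.2, smul_zero]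

variable (T : BaerTower F s F₀ K₀)

theorem mem_kernelPart {ψ : Module.Dual F K} {y : K} :
    y ∈ T.kernelPart ψ ↔ y ∈ K₀ ∧ ψ y = 0 := Iff.rfl

theorem mem_kernelPart_zero {y : K} : y ∈ T.kernelPart (0 : Module.Dual F K) ↔ y ∈ K₀ := by
  simp [mem_kernelPart]

theorem kernelPart_le (ψ : Module.Dual F K) : T.kernelPart ψ ≤ T.kernelPart 0 :=
  fun _ hy => ⟨hy.1, rfl⟩

theorem finrank_kernelPart_zero : Module.finrank F₀ (T.kernelPart 0) = 3 := by
  have h : Nat.card (T.kernelPart 0) = s ^ 3 := by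
    rw [← T.card_cubic]
    exact Nat.card_congr (Equiv.subtypeEquivRight fun y => T.mem_kernelPart_zero)
  rw [Module.natCard_eq_pow_finrank (K := F₀), T.card_base] at h
  exact Nat.pow_right_injective T.one_lt h

theorem kernelPart_lt {ψ : Module.Dual F K} (hψ : ψ ≠ 0) : T.kernelPart ψ < T.kernelPart 0 := by
  refine lt_of_le_of_ne (T.kernelPart_le ψ) fun h => hψ (T.eq_zero_of_forall_cubic fun y hy => ?_)
  have hy' : y ∈ T.kernelPart ψ := h ▸ T.mem_kernelPart_zero.2 hy
  exact hy'.2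

theorem finrank_kernelPart_le {ψ : Module.Dual F K} (hψ : ψ ≠ 0) :
    Module.finrank F₀ (T.kernelPart ψ) ≤ 2 := by
  have := Submodule.finrank_lt_finrank_of_lt (T.kernelPart_lt hψ)
  rw [T.finrank_kernelPart_zero] at this
  omega

/-- A map from `K₀`, with `s ^ 3` elements, to `F`, with `s ^ 2`, is not injective: every line meets
the subplane. -/
theorem finrank_kernelPart_pos (ψ : Module.Dual F K) :
    0 < Module.finrank F₀ (T.kernelPart ψ) := by
  have hs := T.one_lt
  by_contra h
  have hbot : T.kernelPart ψ = ⊥ := Submodule.finrank_eq_zero.1 (by omega)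
  have : Finite F := Finite.of_injective _ (algebraMap F K).injective
  have := Nat.card_le_card_of_injective (fun y : K₀ => ψ y) fun y y' hyy => by
    have : (y - y' : K) ∈ T.kernelPart ψ :=
      ⟨sub_mem y.2 y'.2, by rw [map_sub, sub_eq_zero]; exact hyy⟩
    rw [hbot, Submodule.mem_bot, sub_eq_zero] at this
    exact Subtype.ext this
  rw [T.card_cubic, T.card_field] at this
  exact absurd this (not_le.2 (Nat.pow_lt_pow_right hs (by norm_num)))

theorem natCard_projectivization_kernelPart (ψ : Module.Dual F K) :
    Nat.card (ℙ F₀ (T.kernelPart ψ)) =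
      ∑ i ∈ Finset.range (Module.finrank F₀ (T.kernelPart ψ)), s ^ i := by
  rw [Projectivization.card_of_finrank F₀ (T.kernelPart ψ) rfl, T.card_base]

theorem natCard_projectivization_eq (ψ : Module.Dual F K) (hψ : ψ ≠ 0) :
    Nat.card (ℙ F₀ (T.kernelPart ψ)) = 1 ∧ Module.finrank F₀ (T.kernelPart ψ) = 1 ∨
      Nat.card (ℙ F₀ (T.kernelPart ψ)) = s + 1 ∧ Module.finrank F₀ (T.kernelPart ψ) = 2 := by
  have h1 := T.finrank_kernelPart_pos ψ
  have h2 := T.finrank_kernelPart_le hψ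
  rw [natCard_projectivization_kernelPart]
  interval_cases Module.finrank F₀ (T.kernelPart ψ)
  · simp
  · right
    simp [Finset.sum_range_succ, add_comm]

/-- Two lines of the Baer subplane have a common point. -/
theorem exists_mem_kernelPart_inf {ψ ψ' : Module.Dual F K}
    (h : Module.finrank F₀ (T.kernelPart ψ) = 2) (h' : Module.finrank F₀ (T.kernelPart ψ') = 2) :
    ∃ y ≠ 0, y ∈ T.kernelPart ψ ∧ y ∈ T.kernelPart ψ' := by
  have h1 := Submodule.finrank_sup_add_finrank_inf_eq (T.kernelPart ψ) (T.kernelPart ψ')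
  have h2 := Submodule.finrank_mono (sup_le (T.kernelPart_le ψ) (T.kernelPart_le ψ'))
  rw [T.finrank_kernelPart_zero] at h2
  have h3 : T.kernelPart ψ ⊓ T.kernelPart ψ' ≠ ⊥ := by
    intro hb
    rw [hb, finrank_bot] at h1
    omega
  obtain ⟨y, hy, hy0⟩ := Submodule.exists_mem_ne_zero_of_ne_bot h3
  exact ⟨y, hy0, hy.1, hy.2⟩

end BaerTower

/-! ### Baer subplanes in homogeneous coordinates. -/

section Lines

variable {F K : Type*} [Field F] [Field K] [Algebra F K] (L : K ≃ₗ[F] (Fin 3 → F))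

/-- Functionals on `K` and homogeneous coordinates of lines. -/
noncomputable def lineCoordinates : (Fin 3 → F) ≃ₗ[F] Module.Dual F K :=
  (dotProductEquiv F (Fin 3)).trans L.dualMap

theorem pgInc_mk_iff {z : K} (hz : L z ≠ 0) {w : Fin 3 → F} (hw : w ≠ 0) :
    pgInc F (Projectivization.mk F (L z) hz) (Projectivization.mk F w hw) ↔
      lineCoordinates L w z = 0 := by
  rw [pgInc, Projectivization.orthogonal_mk, dotProduct_comm]
  rfl

theorem exists_dual_of_line (l : ℙ F (Fin 3 → F)) : ∃ ψ : Module.Dual F K, ψ ≠ 0 ∧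
    ∀ z (hz : L z ≠ 0), pgInc F (Projectivization.mk F (L z) hz) l ↔ ψ z = 0 := by
  induction l with | h w hw =>
  exact ⟨lineCoordinates L w, by simpa using hw, fun z hz => pgInc_mk_iff L hz hw⟩

theorem pgInc_unique {p p' l l' : ℙ F (Fin 3 → F)} (h1 : pgInc F p l) (h2 : pgInc F p' l)
    (h3 : pgInc F p l') (h4 : pgInc F p' l') : p = p' ∨ l = l' :=
  Configuration.ofField.eq_or_eq_of_orthogonal h1 h2 h3 h4

theorem exists_pgInc_pair (p p' : ℙ F (Fin 3 → F)) : ∃ l, pgInc F p l ∧ pgInc F p' l := by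
  induction p with | h w hw =>
  induction p' with | h w' hw' =>
  obtain ⟨ψ, hψ, h1, h2⟩ := exists_dual_eq_zero_pair (F := F) (V := Fin 3 → F) (by simp) w w'
  obtain ⟨u, rfl⟩ := (dotProductEquiv F (Fin 3)).surjective ψ
  have hu : u ≠ 0 := by simpa using hψ
  refine ⟨Projectivization.mk F u hu, ?_, ?_⟩ <;>
    rwa [pgInc, Projectivization.orthogonal_mk, dotProduct_comm]

end Lines

/-- The points of the multiple `c * K₀` of a subfield. -/
def multiplePoints {F K : Type*} [Field F] [Field K] [Algebra F K] (L : K ≃ₗ[F] (Fin 3 → F))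
    (c : Kˣ) (K₀ : Subfield K) : Set (ℙ F (Fin 3 → F)) :=
  {p | ∃ y ∈ K₀, ∃ h : L (c * y) ≠ 0, p = Projectivization.mk F (L (c * y)) h}

namespace BaerTower

variable {F K : Type*} [Field F] [Field K] [Algebra F K] [Finite K] {s : ℕ} {F₀ K₀ : Subfield K}
  (L : K ≃ₗ[F] (Fin 3 → F)) (c : Kˣ)

omit [Finite K] in
theorem comp_mulLeft_ne_zero {ψ : Module.Dual F K} (hψ : ψ ≠ 0) :
    ψ ∘ₗ LinearMap.mulLeft F (c : K) ≠ 0 := by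
  contrapose! hψ
  ext z
  simpa using LinearMap.congr_fun hψ ((c⁻¹ : Kˣ) * z)

/-- Multiples `c * y` and `c * y'` with `y`, `y'` in `K₀` are proportional over `F` only if they are
proportional over `F₀`, as the factor lies in `K₀ ∩ F`. So the intersection is a projective space
over `F₀`. -/
theorem ncard_line_inter (T : BaerTower F s F₀ K₀) {l : ℙ F (Fin 3 → F)} {ψ : Module.Dual F K}
    (hl : ∀ z (hz : L z ≠ 0), pgInc F (Projectivization.mk F (L z) hz) l ↔ ψ z = 0) :
    {p ∈ multiplePoints L c K₀ | pgInc F p l}.ncard =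
      Nat.card (ℙ F₀ (T.kernelPart (ψ ∘ₗ LinearMap.mulLeft F (c : K)))) := by
  set W := T.kernelPart (ψ ∘ₗ LinearMap.mulLeft F (c : K))
  have hne : ∀ y : W, y ≠ 0 → L (c * y) ≠ 0 := fun y hy => by simpa using hy
  let g : ℙ F₀ W → ℙ F (Fin 3 → F) := fun p =>
    Projectivization.mk F (L (c * (p.rep : K))) (hne _ p.rep_nonzero)
  have hg : Function.Injective g := by
    intro p p' h
    simp only [g, Projectivization.mk_eq_mk_iff'] at h
    obtain ⟨a, ha⟩ := h
    rw [← map_smul, L.injective.eq_iff, Algebra.smul_def, mul_left_comm] at ha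
    have ha' := mul_left_cancel₀ c.ne_zero ha
    have h0 : (p'.rep : K) ≠ 0 := by simpa using p'.rep_nonzero
    have hmem : algebraMap F K a ∈ F₀ := by
      apply T.mem_base_of_mem_field _ ⟨a, rfl⟩
      rw [eq_div_of_mul_eq h0 ha']
      exact div_mem (W.mem_carrier.1 p.rep.2).1 (W.mem_carrier.1 p'.rep.2).1
    rw [← p.mk_rep, ← p'.mk_rep, Projectivization.mk_eq_mk_iff']
    exact ⟨⟨_, hmem⟩, Subtype.ext ha'⟩
  have hrange : {p ∈ multiplePoints L c K₀ | pgInc F p l} = Set.range g := by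
    ext p
    constructor
    · rintro ⟨⟨y, hy, h, rfl⟩, hp⟩
      rw [hl] at hp
      have hyW : y ∈ W := ⟨hy, hp⟩
      have hy0 : (⟨y, hyW⟩ : W) ≠ 0 := by
        intro h0
        apply h
        rw [show y = 0 from congrArg Subtype.val h0, mul_zero, map_zero]
      refine ⟨Projectivization.mk F₀ ⟨y, hyW⟩ hy0, ?_⟩
      obtain ⟨a, ha⟩ := Projectivization.exists_smul_eq_mk_rep F₀ _ hy0
      obtain ⟨b, hb⟩ := T.mem_field_of_mem_base (a : F₀).2
      simp only [g]
      rw [Projectivization.mk_eq_mk_iff']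
      refine ⟨b, ?_⟩
      rw [← map_smul, ← ha, Algebra.smul_def, hb]
      congr 1
      simp only [Units.smul_def, Submodule.coe_smul, Subfield.smul_def, smul_eq_mul]
      ring
    · rintro ⟨p, rfl⟩
      have := W.mem_carrier.1 p.rep.2
      exact ⟨⟨_, this.1, hne _ p.rep_nonzero, rfl⟩, (hl _ _).2 this.2⟩
  rw [hrange, ← Nat.card_coe_set_eq, Nat.card_range_of_injective hg]

theorem ncard_line_inter_eq (T : BaerTower F s F₀ K₀) (l : ℙ F (Fin 3 → F)) :
    {p ∈ multiplePoints L c K₀ | pgInc F p l}.ncard = 1 ∨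
      {p ∈ multiplePoints L c K₀ | pgInc F p l}.ncard = s + 1 := by
  obtain ⟨ψ, hψ, hl⟩ := exists_dual_of_line L l
  rw [T.ncard_line_inter L c hl]
  exact (T.natCard_projectivization_eq _ (comp_mulLeft_ne_zero c hψ)).imp And.left And.left

/-- The points of `c * K₀` form a Baer subplane. -/
theorem isSubplaneOfOrder (T : BaerTower F s F₀ K₀) :
    IsSubplaneOfOrder (pgInc F) (multiplePoints L c K₀) s where
  join p _ p' _ hp := by
    obtain ⟨l, hl⟩ := exists_pgInc_pair p p'
    exact ⟨l, hl, fun l' hl' => (pgInc_unique hl'.1 hl'.2 hl.1 hl.2).resolve_left hp⟩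
  meet l l' hll h h' := by
    obtain ⟨ψ, hψ, hl⟩ := exists_dual_of_line L l
    obtain ⟨ψ', hψ', hl'⟩ := exists_dual_of_line L l'
    rw [T.ncard_line_inter L c hl] at h
    rw [T.ncard_line_inter L c hl'] at h'
    have h2 := T.natCard_projectivization_eq _ (comp_mulLeft_ne_zero c hψ)
    have h2' := T.natCard_projectivization_eq _ (comp_mulLeft_ne_zero c hψ')
    obtain ⟨y, hy0, hy, hy'⟩ := T.exists_mem_kernelPart_inf
      (h2.resolve_left fun h' => by omega).2 (h2'.resolve_left fun h' => by omega).2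
    have hne : L (c * y) ≠ 0 := by simpa using hy0
    refine ⟨_, ⟨⟨y, hy.1, hne, rfl⟩, (hl _ _).2 hy.2, (hl' _ _).2 hy'.2⟩, fun p hp => ?_⟩
    exact (pgInc_unique hp.2.1 ((hl _ _).2 hy.2) hp.2.2 ((hl' _ _).2 hy'.2)).resolve_right hll
  card_line l h := (T.ncard_line_inter_eq L c l).resolve_left fun h' => by omega
  quadrangle := by
    have hfin : Module.Finite F₀ (T.kernelPart (0 : Module.Dual F K)) := .of_finite
    let b := Module.finBasisOfFinrankEq F₀ _ T.finrank_kernelPart_zero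
    -- The standard frame of the `F₀`-space `K₀`: any three of the four vectors span it, so no
    -- nonzero functional kills three of them.
    let y : Fin 4 → T.kernelPart (0 : Module.Dual F K) := ![b 0, b 1, b 2, b 0 + b 1 + b 2]
    have hspan : ∀ W : Submodule F₀ (T.kernelPart (0 : Module.Dual F K)), ∀ m : Fin 4,
        (∀ i ≠ m, y i ∈ W) → W = ⊤ := by
      intro W m hm
      have hb : b 0 ∈ W ∧ b 1 ∈ W ∧ b 2 ∈ W := by
        have h0 := hm 0
        have h1 := hm 1
        have h2 := hm 2
        have h3 := hm 3
        fin_cases m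
        · simp [y] at h1 h2 h3
          exact ⟨by simpa using W.sub_mem (W.sub_mem h3 h2) h1, h1, h2⟩
        · simp [y] at h0 h2 h3
          refine ⟨h0, ?_, h2⟩
          have := W.sub_mem (W.sub_mem h3 h2) h0
          simpa using this
        · simp [y] at h0 h1 h3
          exact ⟨h0, h1, by simpa using W.sub_mem h3 (W.add_mem h0 h1)⟩
        · simp [y] at h0 h1 h2
          exact ⟨h0, h1, h2⟩
      rw [eq_top_iff, ← b.span_eq, Submodule.span_le]
      rintro _ ⟨i, rfl⟩
      fin_cases i
      exacts [hb.1, hb.2.1, hb.2.2]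
    have hfour : ∀ i j k : Fin 4, i ≠ j → i ≠ k → j ≠ k →
        ∃ m, ∀ n, n ≠ m → n = i ∨ n = j ∨ n = k := by decide
    have key : ∀ ψ : Module.Dual F K, ψ ≠ 0 → ∀ i j k, i ≠ j → i ≠ k → j ≠ k →
        ¬ (ψ (y i) = 0 ∧ ψ (y j) = 0 ∧ ψ (y k) = 0) := by
      rintro ψ hψ i j k hij hik hjk ⟨hi, hj, hk⟩
      obtain ⟨m, hm⟩ := hfour i j k hij hik hjk
      have := hspan ((T.kernelPart ψ).comap (T.kernelPart 0).subtype) m fun n hn => by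
        refine ⟨(y n).2.1, ?_⟩
        rcases hm n hn with rfl | rfl | rfl <;> assumption
      refine (T.kernelPart_lt hψ).not_ge fun z hz => ?_
      exact (this ▸ Submodule.mem_top :
        (⟨z, hz⟩ : T.kernelPart 0) ∈ (T.kernelPart ψ).comap (T.kernelPart 0).subtype)
    have hthird : ∀ i j : Fin 4, ∃ k, i ≠ k ∧ j ≠ k := by decide
    have hy0 : ∀ i, (y i : K) ≠ 0 := by
      intro i h0
      obtain ⟨j, hij, -⟩ := hthird i i
      obtain ⟨k, hik, hjk⟩ := hthird i j
      -- Were `y i` zero, a functional killing two of the others would kill three frame vectors.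
      obtain ⟨ψ, hψ, h1, h2⟩ := exists_dual_eq_zero_pair T.finrank_top (y j : K) (y k)
      exact key ψ hψ i j k hij hik hjk ⟨by rw [h0, map_zero], h1, h2⟩
    have hne : ∀ i, L (c * y i) ≠ 0 := fun i => by simpa using hy0 i
    have hcol : ∀ i j k, i ≠ j → i ≠ k → j ≠ k →
        ¬ ∃ l, pgInc F (Projectivization.mk F _ (hne i)) l ∧
          pgInc F (Projectivization.mk F _ (hne j)) l ∧
          pgInc F (Projectivization.mk F _ (hne k)) l := by
      rintro i j k hij hik hjk ⟨l, h1, h2, h3⟩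
      obtain ⟨ψ, hψ, hl⟩ := exists_dual_of_line L l
      exact key _ (comp_mulLeft_ne_zero c hψ) i j k hij hik hjk
        ⟨(hl _ _).1 h1, (hl _ _).1 h2, (hl _ _).1 h3⟩
    refine ⟨fun i => Projectivization.mk F _ (hne i), fun i j h => ?_,
      fun i => ⟨y i, (y i).2.1, hne i, rfl⟩, hcol⟩
    by_contra hij
    obtain ⟨k, hik, hjk⟩ := hthird i j
    obtain ⟨l, h1, h2⟩ := exists_pgInc_pair (Projectivization.mk F _ (hne i))
      (Projectivization.mk F _ (hne k))
    exact hcol i j k hij hik hjk ⟨l, h1, by simpa only [h] using h1, h2⟩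

end BaerTower

/-! ### The cyclic numbering of the projective plane of order `s ^ 2`. -/

theorem mem_orbitClass_iff {P : Type*} {t d : ℕ} [NeZero t] [NeZero d] (e : ZMod (t * d) ≃ P)
    {u : ℕ} (hu : u < t) (i : ZMod (t * d)) :
    e i ∈ orbitClass t d e u ↔ ZMod.castHom (dvd_mul_right t d) (ZMod t) i = (u : ZMod t) := by
  constructor
  · rintro ⟨b, -, h⟩
    rw [e.injective h, map_natCast]
    simp
  · intro h
    obtain ⟨⟨j, b⟩, rfl⟩ := position_bijective.2 i
    rw [castHom_position] at h
    obtain rfl : j = ⟨u, hu⟩ := ZMod.natCast_fin_injective h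
    exact ⟨b, b.2, rfl⟩

theorem natCard_points_on_line {F : Type*} [Field F] [Finite F] {q : ℕ}
    (h : Nat.card (ℙ F (Fin 3 → F)) = q ^ 2 + q + 1) (l : ℙ F (Fin 3 → F)) :
    Nat.card {p // pgInc F p l} = q + 1 := by
  classical
  open Configuration Configuration.ofField in
  have : Fintype (ℙ F (Fin 3 → F)) := Fintype.ofFinite _
  have h1 := ProjectivePlane.card_points (ℙ F (Fin 3 → F)) (ℙ F (Fin 3 → F))
  have h2 : Nat.card {p // pgInc F p l} = _ :=
    ProjectivePlane.pointCount_eq (P := ℙ F (Fin 3 → F)) l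
  rw [← Nat.card_eq_fintype_card, h] at h1
  rw [h2]
  nlinarith

/-- A cyclic numbering of the projective plane of square order for which the residue classes are
Baer subplanes, and the corresponding ruler. -/
theorem exists_cyclicNumbering_pg (F : Type*) [Field F] [Finite F] {s t d : ℕ}
    (hF : Nat.card F = s ^ 2) (ht : t = s ^ 2 - s + 1) (hd : d = s ^ 2 + s + 1) :
    ∃ (S : Finset (ZMod (t * d))) (e f : ZMod (t * d) ≃ ℙ F (Fin 3 → F)),
      (∀ i j, pgInc F (e i) (f j) ↔ i - j ∈ S) ∧
      IsModularGolombRuler (t * d) (s ^ 2 + 1) S ∧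
      (∀ u < t, IsSubplaneOfOrder (pgInc F) (orbitClass t d e u) s) ∧
      ∀ u, (S.filter fun i => ZMod.castHom (dvd_mul_right t d) (ZMod t) i = u).card =
        if u = 0 then s + 1 else 1 := by
  classical
  have : NeZero t := ⟨by omega⟩
  have : NeZero d := ⟨by omega⟩
  obtain ⟨p, hp⟩ := CharP.exists F
  have : Fact p.Prime := ⟨CharP.char_is_prime F p⟩
  let K := FiniteField.Extension F p 3
  have : Finite K := inferInstanceAs (Finite (FiniteField.Extension F p 3))
  have : Module.Finite F K := .of_finite
  have hK : Module.finrank F K = 3 := FiniteField.finrank_extension F p 3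
  obtain ⟨F₀, K₀, T⟩ := exists_baerTower hF hK
  have hs := T.one_lt
  have hss : s ≤ s ^ 2 := Nat.le_self_pow two_ne_zero s
  have htd : t * d = (s ^ 2) ^ 2 + s ^ 2 + 1 := by
    rw [ht, hd]
    zify [hss]
    ring
  have hcard : Nat.card Kˣ = t * d * (Nat.card F - 1) := by
    have h1 : 1 ≤ s ^ 2 := by omega
    have h2 : 1 ≤ s ^ 6 := Nat.one_le_pow _ _ (by omega)
    rw [Nat.card_units, T.card_top, hF, htd]
    zify [h1, h2]
    ring
  obtain ⟨lg, lg_surj, lg_one⟩ := exists_log (F := F) hcard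
  have lg_surj' : ∀ i : ZMod (t * d), ∃ z, (lg z).toAdd = i := fun i => by
    obtain ⟨z, hz⟩ := lg_surj (Multiplicative.ofAdd i)
    exact ⟨z, by rw [hz, toAdd_ofAdd]⟩
  obtain ⟨L⟩ : Nonempty (K ≃ₗ[F] (Fin 3 → F)) :=
    FiniteDimensional.nonempty_linearEquiv_of_finrank_eq (by rw [hK]; simp)
  -- a functional which vanishes on a line of the Baer subplane of `K₀`
  obtain ⟨y₀, hy₀, hy₀'⟩ : ∃ y ∈ K₀, y ∉ F₀ := by
    by_contra! h
    have := Nat.card_mono (Set.toFinite (F₀ : Set K)) (show (K₀ : Set K) ⊆ F₀ from h)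
    rw [show Nat.card (K₀ : Set K) = s ^ 3 from T.card_cubic,
      show Nat.card (F₀ : Set K) = s ^ 1 from T.card_base.trans (pow_one s).symm] at this
    exact absurd this (not_le.2 (Nat.pow_lt_pow_right hs (by norm_num)))
  obtain ⟨φ, hφ, hφ1, hφy⟩ := exists_dual_eq_zero_pair hK 1 y₀
  obtain ⟨Φ, hΦ⟩ := exists_dualEquiv hφ
  let L' := Φ.trans (lineCoordinates L).symm
  obtain ⟨e, he⟩ := exists_numbering lg_surj lg_one L
  obtain ⟨e', he'⟩ := exists_numbering lg_surj lg_one L'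
  -- The sign turns the condition `φ (w * z) = 0`, which depends on the sum of the logarithms, into
  -- one on the difference of the indices.
  let f := (Equiv.neg (ZMod (t * d))).trans e'
  have hinc : ∀ z w : Kˣ, pgInc F (e (lg z).toAdd) (f (-(lg w).toAdd)) ↔ φ (w * z) = 0 := by
    intro z w
    simp only [f, Equiv.trans_apply, Equiv.neg_apply, neg_neg]
    rw [he z (by simp), he' w (by simp), pgInc_mk_iff, ← hΦ]
    simp [L']
  let S : Finset (ZMod (t * d)) := Finset.univ.filter fun i => pgInc F (e i) (f 0)
  have mem_S : ∀ i, i ∈ S ↔ pgInc F (e i) (f 0) := fun i => by simp [S]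
  have hI : ∀ i j, pgInc F (e i) (f j) ↔ i - j ∈ S := by
    intro i j
    obtain ⟨z, rfl⟩ := lg_surj' i
    obtain ⟨w, hw⟩ := lg_surj' (-j)
    obtain rfl : j = -(lg w).toAdd := by rw [hw, neg_neg]
    have h1 : (lg z).toAdd - -(lg w).toAdd = (lg (w * z)).toAdd := by
      rw [map_mul, toAdd_mul]
      ring
    have h2 : (0 : ZMod (t * d)) = -(lg 1).toAdd := by simp
    rw [hinc, mem_S, h1, h2, hinc]
    simp
  -- the residue classes
  have hclass : ∀ (c : Kˣ) (i : ZMod (t * d)), e i ∈ multiplePoints L c K₀ ↔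
      ZMod.castHom (dvd_mul_right t d) (ZMod t) i =
        ZMod.castHom (dvd_mul_right t d) (ZMod t) (lg c).toAdd := by
    intro c i
    obtain ⟨z, rfl⟩ := lg_surj' i
    -- Congruence modulo `t` means that `d` times the logarithm of `z / c` vanishes, that is, `(z /
    -- c) ^ d` lies in `F`.
    have h1 : ZMod.castHom (dvd_mul_right t d) (ZMod t) (lg z).toAdd =
        ZMod.castHom (dvd_mul_right t d) (ZMod t) (lg c).toAdd ↔
        ∃ a : F, ∃ y ∈ K₀, ((z / c : Kˣ) : K) = algebraMap F K a * y := by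
      rw [← T.exists_mul_cubic_iff, ← hd, ← lg_one, map_pow, ← sub_eq_zero, ← map_sub, ← toAdd_div,
        ← map_div, ← ZMod.nsmul_eq_zero_iff_castHom, ← toAdd_pow, toAdd_eq_zero]
    rw [h1, he z (by simp)]
    constructor
    · rintro ⟨y, hy, h, hz⟩
      rw [Projectivization.mk_eq_mk_iff'] at hz
      obtain ⟨a, ha⟩ := hz
      rw [← map_smul, L.injective.eq_iff, Algebra.smul_def] at ha
      refine ⟨a, y, hy, ?_⟩
      rw [Units.val_div_eq_div_val, ← ha, div_eq_iff c.ne_zero]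
      ring
    · rintro ⟨a, y, hy, h⟩
      rw [Units.val_div_eq_div_val, div_eq_iff c.ne_zero] at h
      have hy0 : y ≠ 0 := by
        rintro rfl
        rw [mul_zero, zero_mul] at h
        exact z.ne_zero h
      refine ⟨y, hy, by simpa using hy0, ?_⟩
      rw [Projectivization.mk_eq_mk_iff']
      refine ⟨a, ?_⟩
      rw [← map_smul, Algebra.smul_def, h]
      congr 1
      ring
  have horbit : ∀ u < t, ∀ c : Kˣ,
      ZMod.castHom (dvd_mul_right t d) (ZMod t) (lg c).toAdd = (u : ZMod t) →
      orbitClass t d e u = multiplePoints L c K₀ := by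
    intro u hu c hc
    ext p
    obtain ⟨i, rfl⟩ := e.surjective p
    rw [mem_orbitClass_iff e hu, hclass, hc]
  have hlift : ∀ u : ZMod t, ∃ c : Kˣ,
      ZMod.castHom (dvd_mul_right t d) (ZMod t) (lg c).toAdd = u := by
    intro u
    obtain ⟨i, rfl⟩ := ZMod.castHom_surjective (dvd_mul_right t d) u
    obtain ⟨c, rfl⟩ := lg_surj' i
    exact ⟨c, rfl⟩
  -- the weights
  have hweight : ∀ c : Kˣ, (S.filter fun i => ZMod.castHom (dvd_mul_right t d) (ZMod t) i =
      ZMod.castHom (dvd_mul_right t d) (ZMod t) (lg c).toAdd).card =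
      {p ∈ multiplePoints L c K₀ | pgInc F p (f 0)}.ncard := by
    intro c
    rw [← Set.ncard_coe_finset, ← Set.ncard_image_of_injective _ e.injective]
    congr 1
    ext p
    obtain ⟨i, rfl⟩ := e.surjective p
    rw [e.injective.mem_set_image, Finset.mem_coe, Finset.mem_filter, mem_S, and_comm]
    exact and_congr_left fun _ => (hclass c i).symm
  have hSc : S.card = s ^ 2 + 1 := by
    have h1 : Nat.card (ℙ F (Fin 3 → F)) = (s ^ 2) ^ 2 + s ^ 2 + 1 := by
      rw [← Nat.card_congr e, Nat.card_zmod, htd]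
    rw [← natCard_points_on_line h1 (f 0), ← Nat.card_eq_finsetCard]
    exact Nat.card_congr (e.subtypeEquiv mem_S)
  have hge : ∀ u, 1 ≤ (S.filter fun i =>
      ZMod.castHom (dvd_mul_right t d) (ZMod t) i = u).card := by
    intro u
    obtain ⟨c, rfl⟩ := hlift u
    rw [hweight]
    rcases T.ncard_line_inter_eq L c (f 0) with h | h <;> rw [h]
    omega
  have hzero : (S.filter fun i => ZMod.castHom (dvd_mul_right t d) (ZMod t) i = 0).card = s + 1 := by
    have h0 := hweight 1
    rw [map_one, toAdd_one, map_zero] at h0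
    rw [h0]
    -- The points of `1` and `y₀` both lie on line `0` and in the class of `0`, and they differ
    -- because `y₀` is not in `F`.
    refine (T.ncard_line_inter_eq L 1 (f 0)).resolve_left fun h1 => ?_
    rw [Set.ncard_eq_one] at h1
    obtain ⟨p, hp⟩ := h1
    have hmem : ∀ z : Kˣ, (z : K) ∈ K₀ → φ z = 0 → e (lg z).toAdd = p := by
      intro z hz hφz
      have : e (lg z).toAdd ∈ {p ∈ multiplePoints L 1 K₀ | pgInc F p (f 0)} := by
        refine ⟨⟨z, hz, by simp, by rw [he z (by simp)]; simp⟩, ?_⟩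
        have := hinc z 1
        rw [map_one, toAdd_one, neg_zero, Units.val_one, one_mul] at this
        exact this.2 hφz
      rw [hp] at this
      exact this
    have hy0 : y₀ ≠ 0 := by
      rintro rfl
      exact hy₀' (zero_mem F₀)
    have h1 := hmem 1 (one_mem K₀) hφ1
    have h2 := hmem (Units.mk0 y₀ hy0) hy₀ hφy
    have h3 : lg (Units.mk0 y₀ hy0) = lg 1 :=
      Multiplicative.toAdd.injective (e.injective (h2.trans h1.symm))
    rw [map_one, lg_one] at h3
    exact hy₀' (T.mem_base_of_mem_field hy₀ h3)
  have hsum : ∑ u : ZMod t, (S.filter fun i =>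
      ZMod.castHom (dvd_mul_right t d) (ZMod t) i = u).card = s ^ 2 + 1 := by
    rw [← hSc]
    exact (Finset.card_eq_sum_card_fiberwise (by simp)).symm
  refine ⟨S, e, f, hI, ⟨hSc, ?_⟩, ?_, ?_⟩
  · intro a ha b hb a' ha' b' hb' hab _ h
    have e1 : a' - (a - b) = b' := by rw [h]; ring
    -- A repeated difference puts the points `a` and `a'` on both line `0` and line `a - b`.
    have h1 : pgInc F (e a) (f (a - b)) := (hI _ _).2 (by rwa [sub_sub_cancel])
    have h2 : pgInc F (e a') (f (a - b)) := (hI _ _).2 (by rwa [e1])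
    rcases pgInc_unique ((mem_S _).1 ha) ((mem_S _).1 ha') h1 h2 with h3 | h3
    · have haa := e.injective h3
      refine ⟨haa, ?_⟩
      rw [haa] at h
      exact sub_right_injective h
    · exact absurd (sub_eq_zero.1 (f.injective h3).symm) hab
  · intro u hu
    obtain ⟨c, hc⟩ := hlift u
    rw [horbit u hu c hc]
    exact T.isSubplaneOfOrder L c
  · intro u
    split_ifs with hu
    · rw [hu, hzero]
    · rw [← Finset.add_sum_erase _ _ (Finset.mem_univ 0), hzero] at hsum
      -- The other `t - 1 = s ^ 2 - s` classes share `(s ^ 2 + 1) - (s + 1)` elements and each has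
      -- at least one, so each has exactly one.
      have hsum' : ∑ u ∈ Finset.univ.erase (0 : ZMod t), 1 = ∑ u ∈ Finset.univ.erase (0 : ZMod t),
          (S.filter fun i => ZMod.castHom (dvd_mul_right t d) (ZMod t) i = u).card := by
        rw [Finset.sum_const, Finset.card_erase_of_mem (Finset.mem_univ _), Finset.card_univ,
          ZMod.card, smul_eq_mul]
        omega
      exact ((Finset.sum_eq_sum_iff_of_le fun u _ => hge u).1 hsum' u
        (Finset.mem_erase.2 ⟨hu, Finset.mem_univ _⟩)).symm

/-- The assertions on the projective plane of square order. -/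
theorem pg_configurations {q s : ℕ} (hqs : q = s ^ 2) (F : Type*) [Field F] [Fintype F]
    [Fintype (ℙ F (Fin 3 → F))] (hq : Fintype.card F = q) :
    IsSymmConfig (pgInc F) (q ^ 2 + q + 1) (q + 1) ∧
    ∃ (e : ZMod ((q - s + 1) * (q + s + 1)) ≃ ℙ F (Fin 3 → F))
      (f : ZMod ((q - s + 1) * (q + s + 1)) ≃ ℙ F (Fin 3 → F)),
      IsCyclicNumbering (pgInc F) e f ∧
      (∀ u < q - s + 1,
        IsSubplaneOfOrder (pgInc F) (orbitClass (q - s + 1) (q + s + 1) e u) s) ∧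
      IsBDC (arranged (q - s + 1) (q + s + 1) fun i j => pgInc F (e i) (f j))
        (fun u => if (u : ℕ) = 0 then s + 1 else 1) ∧
      ∀ c θ δ : ℕ, 2 ≤ c → c ≤ q - s + 1 → θ ≤ c + 1 → δ < c →
        YieldsConfig (arranged (q - s + 1) (q + s + 1) fun i j => pgInc F (e i) (f j))
          c θ (c - δ) := by
  obtain ⟨S, e, f, hI, hS, hsub, hw⟩ := exists_cyclicNumbering_pg F
    (t := q - s + 1) (d := q + s + 1)
    ((Nat.card_eq_fintype_card.trans hq).trans hqs) (by rw [hqs]) (by rw [hqs])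
  rw [← hqs] at hS
  have hb : IsBDC (arranged (q - s + 1) (q + s + 1) fun i j => i - j ∈ S)
      (fun u => if (u : ℕ) = 0 then s + 1 else 1) := by
    refine isBDC_arranged fun u => (hw _).trans ?_
    have : ((u : ℕ) : ZMod (q - s + 1)) = 0 ↔ (u : ℕ) = 0 := by
      rw [ZMod.natCast_eq_zero_iff]
      exact ⟨fun h => Nat.eq_zero_of_dvd_of_lt h u.2, fun h => h ▸ dvd_zero _⟩
    simp only [this]
  refine ⟨?_, e, f, fun i j => ?_, hsub, ?_⟩
  · have hv : q ^ 2 + q + 1 = (q - s + 1) * (q + s + 1) := by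
      have : s ≤ s ^ 2 := Nat.le_self_pow two_ne_zero s
      rw [hqs]
      zify [this]
      ring
    rw [hv]
    exact hS.isSymmConfig e f hI
  · rw [hI, hI, add_sub_add_right_eq_sub]
  · simp only [hI]
    exact ⟨hb, fun c θ δ h2 hc hθ hδ => hb.yieldsConfig_of_pos hS.unique_line_arranged
      (fun u => by split_ifs <;> omega) hc hθ (by omega) (by omega)
      (by omega)⟩

/-! ### The three families of configurations. -/

theorem exists_field_of_isPrimePow {q : ℕ} (hq : IsPrimePow q) :
    ∃ (F : Type) (_ : Field F) (_ : Fintype F), Fintype.card F = q := by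
  obtain ⟨p, n, hp, hn, rfl⟩ := (isPrimePow_nat_iff q).1 hq
  have : Fact p.Prime := ⟨hp⟩
  have := Fintype.ofFinite (GaloisField p n)
  exact ⟨GaloisField p n, inferInstance, this,
    by rw [← Nat.card_eq_fintype_card, GaloisField.card p n hn.ne']⟩

theorem mainTheorem5 :
    -- the starred affine plane of order `q`, with `t = q + 1` and `d = q - 1`
    (∀ q : ℕ, IsPrimePow q →
      (∀ c θ δ : ℕ, 2 ≤ c → c ≤ q + 1 → θ ≤ c + 1 → δ < c - 1 →
        ExistsSymmConfig (c * (q - 1) + θ) (c - 1 - δ)) ∧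
      ∀ (F : Type*) [Field F] [Fintype F] [Fintype (StarredPoint F)] [Fintype (StarredLine F)],
        Fintype.card F = q →
        IsSymmConfig (starredInc F) (q ^ 2 - 1) q ∧
        ∃ (e : ZMod ((q + 1) * (q - 1)) ≃ StarredPoint F)
          (f : ZMod ((q + 1) * (q - 1)) ≃ StarredLine F),
          IsCyclicNumbering (starredInc F) e f ∧
          IsBDC (arranged (q + 1) (q - 1) fun i j => starredInc F (e i) (f j))
            (fun u => if (u : ℕ) = 0 then 0 else 1) ∧
          ∀ c θ δ : ℕ, 2 ≤ c → c ≤ q + 1 → θ ≤ c + 1 → δ < c - 1 →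
            YieldsConfig (arranged (q + 1) (q - 1) fun i j => starredInc F (e i) (f j))
              c θ (c - 1 - δ)) ∧
    -- Ruzsa's ruler, with `t = p - 1`, `d = p` and with `t = p`, `d = p - 1`
    (∀ p : ℕ, p.Prime →
      (∀ c θ δ : ℕ, 2 ≤ c → c ≤ p - 1 → θ ≤ c + 1 → δ < c →
        ExistsSymmConfig (c * p + θ) (c - δ)) ∧
      (∀ c θ δ : ℕ, 2 ≤ c → c ≤ p → θ ≤ c + 1 → δ < c - 1 →
        ExistsSymmConfig (c * (p - 1) + θ) (c - 1 - δ)) ∧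
      ∀ g : ℕ, orderOf (g : ZMod p) = p - 1 →
        IsModularGolombRuler (p ^ 2 - p) (p - 1) (ruzsa p g (p ^ 2 - p)) ∧
        (IsConfigMatrix (arranged (p - 1) p fun i j => i - j ∈ ruzsa p g ((p - 1) * p))
            (p ^ 2 - p) (p - 1) ∧
          IsBDC (arranged (p - 1) p fun i j => i - j ∈ ruzsa p g ((p - 1) * p)) (fun _ => 1) ∧
          ∀ c θ δ : ℕ, 2 ≤ c → c ≤ p - 1 → θ ≤ c + 1 → δ < c →
            YieldsConfig (arranged (p - 1) p fun i j => i - j ∈ ruzsa p g ((p - 1) * p))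
              c θ (c - δ)) ∧
        (IsConfigMatrix (arranged p (p - 1) fun i j => i - j ∈ ruzsa p g (p * (p - 1)))
            (p ^ 2 - p) (p - 1) ∧
          IsBDC (arranged p (p - 1) fun i j => i - j ∈ ruzsa p g (p * (p - 1)))
            (fun u => if (u : ℕ) = 0 then 0 else 1) ∧
          ∀ c θ δ : ℕ, 2 ≤ c → c ≤ p → θ ≤ c + 1 → δ < c - 1 →
            YieldsConfig (arranged p (p - 1) fun i j => i - j ∈ ruzsa p g (p * (p - 1)))
              c θ (c - 1 - δ))) ∧
    -- `PG(2, q)` with `q = s ^ 2` a square, `t = q - s + 1` and `d = q + s + 1`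
    (∀ q s : ℕ, IsPrimePow q → q = s ^ 2 →
      (∀ c θ δ : ℕ, 2 ≤ c → c ≤ q - s + 1 → θ ≤ c + 1 → δ < c →
        ExistsSymmConfig (c * (q + s + 1) + θ) (c - δ)) ∧
      ∀ (F : Type*) [Field F] [Fintype F] [Fintype (ℙ F (Fin 3 → F))],
        Fintype.card F = q →
        IsSymmConfig (pgInc F) (q ^ 2 + q + 1) (q + 1) ∧
        ∃ (e : ZMod ((q - s + 1) * (q + s + 1)) ≃ ℙ F (Fin 3 → F))
          (f : ZMod ((q - s + 1) * (q + s + 1)) ≃ ℙ F (Fin 3 → F)),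
          IsCyclicNumbering (pgInc F) e f ∧
          (∀ u < q - s + 1,
            IsSubplaneOfOrder (pgInc F) (orbitClass (q - s + 1) (q + s + 1) e u) s) ∧
          IsBDC (arranged (q - s + 1) (q + s + 1) fun i j => pgInc F (e i) (f j))
            (fun u => if (u : ℕ) = 0 then s + 1 else 1) ∧
          ∀ c θ δ : ℕ, 2 ≤ c → c ≤ q - s + 1 → θ ≤ c + 1 → δ < c →
            YieldsConfig (arranged (q - s + 1) (q + s + 1) fun i j => pgInc F (e i) (f j))
              c θ (c - δ)) := by
  refine ⟨fun q hq => ⟨fun c θ δ h2 hc hθ hδ => ?_, fun F _ _ _ _ hF =>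
    starredPlane_configurations F hF⟩, fun p hp => ?_, fun q s hq hqs =>
    ⟨fun c θ δ h2 hc hθ hδ => ?_, fun F _ _ _ hF => pg_configurations hqs F hF⟩⟩
  · obtain ⟨F, _, _, hF⟩ := exists_field_of_isPrimePow hq
    have := Fintype.ofFinite (StarredPoint F)
    have := Fintype.ofFinite (StarredLine F)
    obtain ⟨-, e, f, -, -, h⟩ := starredPlane_configurations F hF
    exact (h c θ δ h2 hc hθ hδ).existsSymmConfig
  · obtain ⟨g, hg⟩ := exists_primitive_root hp
    have h := ruzsa_configurations hp hg
    exact ⟨fun c θ δ h2 hc hθ hδ => (h.2.1.2.2 c θ δ h2 hc hθ hδ).existsSymmConfig,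
      fun c θ δ h2 hc hθ hδ => (h.2.2.2.2 c θ δ h2 hc hθ hδ).existsSymmConfig,
      fun g hg => ruzsa_configurations hp hg⟩
  · obtain ⟨F, _, _, hF⟩ := exists_field_of_isPrimePow hq
    have := Fintype.ofFinite (ℙ F (Fin 3 → F))
    obtain ⟨-, e, f, -, -, -, h⟩ := pg_configurations hqs F hF
    exact (h c θ δ h2 hc hθ hδ).existsSymmConfig
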